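/- Theorem 1. Let $K$ be a field of characteristic $0$ (for example $\mathbb{R}$ or $\mathbb{C}$). A variety in $\mathbb{P}^N=\mathbb{P}^N(K)$ is an irreducible Zariski closed set of points of $\mathbb{P}^N$. Let $X\subset\mathbb{P}^N$ be a variety of dimension $n<N$, let $X_{sm}=\{x\in X:\dim T_xX=n\}$ be its set of smooth points, where $T_xX\subset\mathbb{P}^N$ denotes the projective tangent subspace, and let $\gamma:X_{sm}\to\mathbb{G}(n,N)$, $\gamma(x)=T_xX$, be its Gauss map. Let $r$ be the rank of $X$, i.e. the maximal rank of the differential $d\gamma_x$ over $x\in X_{sm}$, and put $l=n-r$. The leaf of the Monge–Ampère foliation of $X$ through $x\in X_{sm}$ is the fibre $L_x=\gamma^{-1}(T_xX)\subset X_{sm}$. The dual variety $X^*\subset(\mathbb{P}^N)^*$ is the Zariski closure of the set of hyperplanes $\xi$ with $T_xX\subset\xi$ for some $x\in X_{sm}$. The variety $X$ is called dually degenerate if $\dim X^*<N-l-1$. For a projective subspace $P\subset\mathbb{P}^N$ let $P^\perp\subset(\mathbb{P}^N)^*$ be the subspace of hyperplanes containing $P$, and, identifying $(\mathbb{P}^N)^{**}$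 with $\mathbb{P}^N$, use the same notation for subspaces of $(\mathbb{P}^N)^*$; let $\langle S\rangle$ denote the linear span of a set $S$. Suppose that $X$ is dually nondegenerate and that its Gauss map is degenerate, i.e. $r<n$. Then $X^*$ is irreducible, $\dim X^*=N-l-1$, and $X^*$ has the same rank $r$. Moreover, there are dense Zariski open subsets $U\subset X$ and $U^*\subset X^*$, consisting of smooth points, such that: (1) for every $x\in U$ the leaf $L_x$ of $X$ is an open part of a projective subspace and has dimension $l=n-r$; (2) for every $\xi\in U^*$ the leaf $L^*_\xi$ of $X^*$ through $\xi$ is an open part of a projective subspace and has dimension $N-n-1$; (3) every $x\in U$ is a point of tangency with $X$ of some hyperplane $\xi\in U^*$, and every hyperplane $\xi\in U^*$ is tangent to $X$ at some $x\in U$; (4) whenever $x\in U$, $\xi\in U^*$ and $T_xX\subset\xi$, we have $\langle L^*_\xi\rangle=(T_xX)^\perp$ and $T_\xi X^*=\langle L_x\rangle^\perp$. Thus under duality the tangent subspaces of $X$ correspond to the leaves of $X^*$, and the leaves of $X$ correspond to the tangent subspaces of $X^*$. -/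

import Mathlib

open scoped LinearAlgebra.Projectivization

noncomputable section

namespace GaussDual

/-- The projective space `ℙ^N` over `K`. The dual projective space is taken in coordinates too:
the point `ξ` of a second copy of `ℙ^N` is the hyperplane `ξ₀ x₀ + ⋯ + ξ_N x_N = 0`. -/
abbrev ProjSpace (K : Type*) [Field K] (N : ℕ) : Type _ := ℙ K (Fin (N + 1) → K)

variable {K : Type*} [Field K] {N : ℕ}

/-- The Zariski topology: closed sets are the common zero sets of homogeneous polynomials. -/
instance zariskiTopology : TopologicalSpace (ProjSpace K N) :=
  TopologicalSpace.ofClosed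
    {Z | ∃ S : Set (MvPolynomial (Fin (N + 1)) K),
      (∀ f ∈ S, ∃ d, f.IsHomogeneous d) ∧ Z = {p | ∀ f ∈ S, MvPolynomial.eval p.rep f = 0}}
    ⟨{1}, by
      rintro f rfl
      exact ⟨0, MvPolynomial.isHomogeneous_one _ _⟩, by
      ext p
      simp⟩
    (by
      intro A hA
      refine ⟨{f | (∃ d, f.IsHomogeneous d) ∧
        ∃ Z ∈ A, ∀ p ∈ Z, MvPolynomial.eval p.rep f = 0}, fun f hf => hf.1, ?_⟩
      ext p
      constructor
      · rintro hp f ⟨-, Z, hZ, hf⟩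
        exact hf p (hp Z hZ)
      · intro hp Z hZ
        obtain ⟨S, hS, hZS⟩ := hA hZ
        rw [hZS]
        intro f hf
        refine hp f ⟨hS f hf, Z, hZ, fun q hq => ?_⟩
        rw [hZS] at hq
        exact hq f hf)
    (by
      rintro _ ⟨S, hS, rfl⟩ _ ⟨T, hT, rfl⟩
      refine ⟨{h | ∃ f ∈ S, ∃ g ∈ T, h = f * g}, ?_, ?_⟩
      · rintro _ ⟨f, hf, g, hg, rfl⟩
        obtain ⟨d, hd⟩ := hS f hf
        obtain ⟨e, he⟩ := hT g hg
        exact ⟨d + e, hd.mul he⟩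
      · ext p
        constructor
        · rintro (hp | hp) _ ⟨f, hf, g, hg, rfl⟩
          · simp [hp f hf]
          · simp [hp g hg]
        · intro hp
          by_contra hcon
          simp only [Set.mem_union, Set.mem_ofPred_eq, not_or, not_forall] at hcon
          obtain ⟨⟨f, hf, hf0⟩, ⟨g, hg, hg0⟩⟩ := hcon
          have h := hp (f * g) ⟨f, hf, g, hg, rfl⟩
          rw [map_mul] at h
          exact (mul_ne_zero hf0 hg0) h)

/-- The affine cone over a subset of projective space. -/
def affineCone (S : Set (ProjSpace K N)) : Set (Fin (N + 1) → K) :=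
  {v | ∃ p ∈ S, v ∈ p.submodule}

/-- The (homogeneous) ideal of all polynomials vanishing on `S`. -/
def idealOf (S : Set (ProjSpace K N)) : Ideal (MvPolynomial (Fin (N + 1)) K) :=
  MvPolynomial.vanishingIdeal K (affineCone S)

/-- The dimension of a subset of `ℙ^N` (equivalently, of its Zariski closure): the transcendence
degree of the homogeneous coordinate ring, minus one. The empty set has dimension `-1`. -/
def projDim (S : Set (ProjSpace K N)) : ℤ :=
  (Cardinal.toNat (Algebra.trdeg K (MvPolynomial (Fin (N + 1)) K ⧸ idealOf S)) : ℤ) - 1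

/-- The projective subspace `ℙ(W)` of `ℙ^N` given by a linear subspace `W` of `K^(N+1)`. -/
def plane (W : Submodule K (Fin (N + 1) → K)) : Set (ProjSpace K N) :=
  {p | p.submodule ≤ W}

/-- The linear span of a subset of `ℙ^N`, as a linear subspace of `K^(N+1)`. -/
def linSpan (S : Set (ProjSpace K N)) : Submodule K (Fin (N + 1) → K) :=
  Submodule.span K (affineCone S)

/-- The subspace dual to `W`: the coordinate vectors of the hyperplanes that contain `W`. -/
def dualSubspace (W : Submodule K (Fin (N + 1) → K)) : Submodule K (Fin (N + 1) → K) where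
  carrier := {ξ | ∀ v ∈ W, ξ ⬝ᵥ v = 0}
  zero_mem' := fun v _ => by simp
  add_mem' := fun ha hb v hv => by rw [add_dotProduct, ha v hv, hb v hv, add_zero]
  smul_mem' := fun c a ha v hv => by rw [smul_dotProduct, ha v hv, smul_zero]

/-- The embedded projective tangent space `T_x X`, as a linear subspace of `K^(N+1)`: the common
kernel of the differentials at `x` of all polynomials vanishing on `X`. -/
def tangentSpace (X : Set (ProjSpace K N)) (x : ProjSpace K N) :
    Submodule K (Fin (N + 1) → K) where
  carrier := {v | ∀ f ∈ idealOf X,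
    ∑ i, MvPolynomial.eval x.rep (MvPolynomial.pderiv i f) * v i = 0}
  zero_mem' := fun f _ => by simp
  add_mem' := fun ha hb f hf => by
    simp only [Pi.add_apply, mul_add, Finset.sum_add_distrib]
    rw [ha f hf, hb f hf, add_zero]
  smul_mem' := fun c a ha f hf => by
    simp only [Pi.smul_apply, smul_eq_mul, mul_left_comm _ c, ← Finset.mul_sum]
    rw [ha f hf, mul_zero]

/-- The smooth (regular) points of `X`: those with `dim T_x X = dim X`. -/
def smoothLocus (X : Set (ProjSpace K N)) : Set (ProjSpace K N) :=
  {x | x ∈ X ∧ (Module.finrank K (tangentSpace X x) : ℤ) - 1 = projDim X}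

/-- The Hessian `∑ ∂ᵢ∂ⱼ f(x) vᵢ wⱼ` of `f` at `x`. -/
def hessian (f : MvPolynomial (Fin (N + 1)) K) (x v w : Fin (N + 1) → K) : K :=
  ∑ i, ∑ j, MvPolynomial.eval x (MvPolynomial.pderiv i (MvPolynomial.pderiv j f)) * v i * w j

/-- The differential at `x` of the Gauss map `γ : y ↦ T_y X`. It is a linear map from tangent
vectors `v` to `Hom(T, V/T)`, the tangent space of the Grassmannian at `T = T_x X`, where
`V = K^(N+1)`. As `T` is the common kernel of the `df(x)`, `f` in the ideal `I` of `X`, the map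
`w' ↦ (df(x) w')_f` embeds `V/T` into `I → K`. If `w` moves to `w + ε w'` so as to stay tangent
while `x` moves to `x + ε v`, then `df(x) w' = - Hess f(x)(v, w)` for every `f ∈ I`. So, read in
`Hom(T, I → K)` and up to the sign, the differential is
`v ↦ (w ↦ (Hess f(x)(v, w))_f)`. -/
def gaussDifferential (X : Set (ProjSpace K N)) (x : ProjSpace K N) :
    tangentSpace X x →ₗ[K] tangentSpace X x →ₗ[K] (idealOf X → K) :=
  LinearMap.mk₂ K (fun v w f => hessian (f : MvPolynomial (Fin (N + 1)) K) x.rep v w)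
    (fun v v' w => by
      funext f
      simp [hessian, mul_add, add_mul, Finset.sum_add_distrib])
    (fun c v w => by
      funext f
      simp only [hessian, Submodule.coe_smul, Pi.smul_apply, smul_eq_mul, Finset.mul_sum]
      exact Finset.sum_congr rfl fun i _ => Finset.sum_congr rfl fun j _ => by ring)
    (fun v w w' => by
      funext f
      simp [hessian, mul_add, Finset.sum_add_distrib])
    (fun c v w => by
      funext f
      simp only [hessian, Submodule.coe_smul, Pi.smul_apply, smul_eq_mul, Finset.mul_sum]
      exact Finset.sum_congr rfl fun i _ => Finset.sum_congr rfl fun j _ => by ring)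

/-- The rank of the Gauss map of `X`, also called the rank of `X`: the largest rank of its
differential at a smooth point (the supremum is over a family bounded by `N + 1`). -/
def gaussRank (X : Set (ProjSpace K N)) : ℕ :=
  ⨆ x : smoothLocus X, Module.finrank K (LinearMap.range (gaussDifferential X x))

/-- The Gauss defect `l = dim X - rank X`. -/
def gaussDefect (X : Set (ProjSpace K N)) : ℤ := projDim X - gaussRank X

/-- The leaf through `x` of the Monge–Ampère foliation of `X`: the fibre `γ⁻¹(T_x X)` of the
Gauss map `γ : X_sm → 𝔾(n, N)`. -/
def leaf (X : Set (ProjSpace K N)) (x : ProjSpace K N) : Set (ProjSpace K N) :=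
  {y | y ∈ smoothLocus X ∧ tangentSpace X y = tangentSpace X x}

/-- The hyperplane `ξ` is tangent to `X` at `x`, i.e. contains `T_x X`. -/
def IsTangentAt (X : Set (ProjSpace K N)) (ξ x : ProjSpace K N) : Prop :=
  ∀ v ∈ tangentSpace X x, ξ.rep ⬝ᵥ v = 0

/-- The dual variety `X*`: the closure of the set of hyperplanes tangent to `X` at smooth
points. -/
def dualVariety (X : Set (ProjSpace K N)) : Set (ProjSpace K N) :=
  closure {ξ | ∃ x ∈ smoothLocus X, IsTangentAt X ξ x}

/-- `X` is dually degenerate if `dim X* < N - l - 1`, where `l` is the Gauss defect of `X`. -/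
def IsDuallyDegenerate (X : Set (ProjSpace K N)) : Prop :=
  projDim (dualVariety X) < (N : ℤ) - gaussDefect X - 1

/-- `U` is a relatively open, dense subset of `X`. -/
def IsDenseOpenIn (U X : Set (ProjSpace K N)) : Prop :=
  (∃ O : Set (ProjSpace K N), IsOpen O ∧ U = O ∩ X) ∧ X ⊆ closure U

/-- `S` is an open part of a projective subspace (which is then its linear span). -/
def IsOpenPartOfPlane (S : Set (ProjSpace K N)) : Prop :=
  ∃ O : Set (ProjSpace K N), IsOpen O ∧ S = O ∩ plane (linSpan S)

end GaussDual

end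

open GaussDual

/-! The argument is run at generic points. Take a tuple `x` over an extension field `L` of `K` whose
algebraic relations over `K` are exactly the ideal of `X`; then every `K`-point of the cone over `X`
is a specialization of `x`, expressed as `relIdeal K x ≤ relIdeal K x₀`. In characteristic 0 the
tangent vectors at `x` are the vectors `(D xᵢ)`, `D` a `K`-derivation of `L`
(`exists_derivation_of_mem_tangent`), so geometric statements follow by differentiating identities
in `L`.

Let `ξ = ∑ tⱼ ∇gⱼ(x)`, where the `∇gⱼ(x)` are a basis of the conormal space and the `tⱼ` are
independent over `K[x]`: `(x, ξ)` is a generic point of the conormal variety. Euler's relation gives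
`x · ξ = 0`; since `ξ · Dx = 0`, differentiation yields `x · Dξ = 0`, so `x` is conormal at `ξ` to
the variety with generic point `ξ`, which is `X*`. The transcendence degree of `L` is `N + 1` as
counted from either side, so `x` is even a generic conormal vector there. This is reflexivity,
`isConormalPair_of_algebraicIndependent`, and it makes the situation symmetric.

If `v` lies in the kernel of the differential of the Gauss map at `x`, differentiating the formula
for `ξ` gives `v · Dξ = 0`. Thus this kernel, of affine dimension `l + 1`, lies in the conormal
space of `X*` at `ξ` (`gaussKer_le_conormal`). Hence `dim X* ≤ N - l - 1`, and dual nondegeneracy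
says precisely that the two spaces coincide. Differentiating `∇f(x) · ∇g(ξ) = 0` then gives the same
equality with the roles exchanged (`conormal_le_gaussKer`), and all dimensions and ranks follow by
counting.

It remains to descend to `K`-points. Polynomial identities specialize, and membership in a span of
polynomial vectors specializes wherever the rank does not drop (`mem_valSpan_of_relIdeal_le`). So at
a regular point `p` of `X` with a smooth point `q` of `X*` tangent there, the conormal space of `X*`
at `q` is the Gauss kernel at `p`. Reflexivity identifies its smooth points with the leaf through
`p` (`IsConormalPair.leaf_eq`). The sets `U` and `U*` consist of the regular points that are in
contact with a regular point on the other side. -/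

namespace GaussDual

open Module

/-! ### Linear algebra: annihilators, minors, ranks of bilinear maps -/

section LinearAlgebra

variable {F : Type*} [Field F] {ι : Type*} [Fintype ι]

/-- The annihilator of `W` with respect to the dot product. -/
def dotAnn (W : Submodule F (ι → F)) : Submodule F (ι → F) where
  carrier := {ξ | ∀ v ∈ W, ξ ⬝ᵥ v = 0}
  zero_mem' := fun v _ => by simp
  add_mem' := fun ha hb v hv => by rw [add_dotProduct, ha v hv, hb v hv, add_zero]
  smul_mem' := fun c a ha v hv => by rw [smul_dotProduct, ha v hv, smul_zero]

theorem mem_dotAnn {W : Submodule F (ι → F)} {ξ : ι → F} :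
    ξ ∈ dotAnn W ↔ ∀ v ∈ W, ξ ⬝ᵥ v = 0 := Iff.rfl

theorem nondegenerate_dotProductBilin :
    LinearMap.BilinForm.Nondegenerate (dotProductBilin F F : (ι → F) →ₗ[F] (ι → F) →ₗ[F] F) := by
  classical
  refine ⟨fun x hx => ?_, fun x hx => ?_⟩
  · exact dotProduct_eq_zero x fun y => hx y
  · exact dotProduct_eq_zero x fun y => by rw [dotProduct_comm]; exact hx y

theorem dotAnn_eq_orthogonal (W : Submodule F (ι → F)) :
    dotAnn W = LinearMap.BilinForm.orthogonal (dotProductBilin F F) W := by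
  ext ξ
  rw [mem_dotAnn, LinearMap.BilinForm.mem_orthogonal_iff]
  refine forall₂_congr fun v _ => ?_
  rw [dotProduct_comm]
  rfl

theorem finrank_dotAnn_add (W : Submodule F (ι → F)) :
    finrank F (dotAnn W) + finrank F W = Fintype.card ι := by
  rw [dotAnn_eq_orthogonal, LinearMap.BilinForm.finrank_orthogonal nondegenerate_dotProductBilin,
    Nat.sub_add_cancel (Submodule.finrank_le W), finrank_fintype_fun_eq_card]

theorem dotAnn_dotAnn (W : Submodule F (ι → F)) : dotAnn (dotAnn W) = W := by
  rw [dotAnn_eq_orthogonal, dotAnn_eq_orthogonal]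
  refine LinearMap.BilinForm.orthogonal_orthogonal nondegenerate_dotProductBilin ?_ W
  intro x y h
  change y ⬝ᵥ x = 0
  rw [dotProduct_comm]
  exact h

theorem le_dotAnn_comm {V W : Submodule F (ι → F)} : V ≤ dotAnn W ↔ W ≤ dotAnn V :=
  ⟨fun h w hw v hv => by rw [dotProduct_comm]; exact h hv w hw,
    fun h w hw v hv => by rw [dotProduct_comm]; exact h hv w hw⟩

theorem mem_dotAnn_span {s : Set (ι → F)} {ξ : ι → F} :
    ξ ∈ dotAnn (Submodule.span F s) ↔ ∀ v ∈ s, ξ ⬝ᵥ v = 0 := by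
  refine ⟨fun h v hv => h v (Submodule.subset_span hv), fun h v hv => ?_⟩
  induction hv using Submodule.span_induction with
  | mem x hx => exact h x hx
  | zero => simp
  | add x y _ _ hx hy => rw [dotProduct_add, hx, hy, add_zero]
  | smul c x _ hx => rw [dotProduct_smul, hx, smul_zero]

/-- Finitely many functions are linearly independent iff one of their maximal minors is nonzero. -/
theorem linearIndependent_iff_exists_minor {κ : Type*} {m : ℕ} (v : Fin m → κ → F) :
    LinearIndependent F v ↔ ∃ c : Fin m → κ, (Matrix.of fun i j => v i (c j)).det ≠ 0 := by
  constructor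
  · intro h
    set s : Set (Fin m → F) := Set.range fun k i => v i k with hs
    have htop : Submodule.span F s = ⊤ := by
      have h0 : dotAnn (Submodule.span F s) = ⊥ := by
        rw [eq_bot_iff]
        intro ξ hξ
        rw [mem_dotAnn_span] at hξ
        rw [Fintype.linearIndependent_iff] at h
        refine (Submodule.mem_bot F).2 (funext fun i => h ξ (funext fun k => ?_) i)
        simpa [dotProduct] using hξ _ ⟨k, rfl⟩
      have := finrank_dotAnn_add (Submodule.span F s)
      rw [h0, finrank_bot, zero_add] at this
      exact Submodule.eq_top_of_finrank_eq (by rw [this, finrank_fintype_fun_eq_card])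
    have hbasis := Submodule.exists_fun_fin_finrank_span_eq F s
    have hm : finrank F (Submodule.span F s) = m := by
      rw [htop, finrank_top, finrank_fintype_fun_eq_card, Fintype.card_fin]
    rw [hm] at hbasis
    obtain ⟨f, hfs, -, hf⟩ := hbasis
    choose c hc using hfs
    refine ⟨c, ?_⟩
    have : IsUnit (Matrix.of f) := Matrix.linearIndependent_rows_iff_isUnit.1 hf
    rw [Matrix.isUnit_iff_isUnit_det, isUnit_iff_ne_zero] at this
    rw [← Matrix.det_transpose]
    convert this using 2
    ext i j
    simp [← hc]
  · rintro ⟨c, hc⟩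
    have h1 : IsUnit (Matrix.of fun i j => v i (c j)) := by
      rw [Matrix.isUnit_iff_isUnit_det, isUnit_iff_ne_zero]; exact hc
    have h2 := Matrix.linearIndependent_rows_iff_isUnit.2 h1
    exact LinearIndependent.of_comp (LinearMap.funLeft F F c) h2

theorem exists_linearIndependent_comp {V J : Type*} [AddCommGroup V] [Module F V] (v : J → V)
    [Module.Finite F (Submodule.span F (Set.range v))] :
    ∃ b : Fin (finrank F (Submodule.span F (Set.range v))) → J, LinearIndependent F (v ∘ b) ∧
      Submodule.span F (Set.range (v ∘ b)) = Submodule.span F (Set.range v) := by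
  obtain ⟨f, hf, hspan, hli⟩ := Submodule.exists_fun_fin_finrank_span_eq F (Set.range v)
  choose b hb using hf
  have : v ∘ b = f := funext hb
  exact ⟨b, by rwa [this], by rwa [this]⟩

theorem le_finrank_of_linearIndependent {V : Type*} [AddCommGroup V] [Module F V]
    {S : Submodule F V} [Module.Finite F S] {m : ℕ} {v : Fin m → V} (hv : LinearIndependent F v)
    (h : ∀ i, v i ∈ S) : m ≤ finrank F S := by
  have := finrank_span_eq_card hv
  rw [Fintype.card_fin] at this
  rw [← this]
  exact Submodule.finrank_mono (Submodule.span_le.2 (by rintro _ ⟨i, rfl⟩; exact h i))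

/-- The rank of a family of values of a bilinear map on a subspace, and its radical. -/
theorem finrank_span_bilin_add_le {V β Φ : Type*} [AddCommGroup V] [Module F V]
    [FiniteDimensional F V] [Finite β]
    (T R : Submodule F V) (B : V →ₗ[F] V →ₗ[F] (Φ → F))
    (hR : ∀ v, v ∈ R ↔ v ∈ T ∧ ∀ w ∈ T, B v w = 0) (w : β → V) (hw : ∀ b, w b ∈ T) :
    finrank F (Submodule.span F (Set.range fun b => fun p : β × Φ => B (w b) (w p.1) p.2))
      + finrank F R ≤ finrank F T := by
  -- The span is contained in the range of `Ψ` and `R` in its kernel, so rank-nullity gives the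
  -- bound. Equality needs the `w b` to span `T`.
  let Ψ : T →ₗ[F] (β × Φ → F) :=
    LinearMap.pi fun p => (LinearMap.proj p.2).comp ((B.flip (w p.1)).comp T.subtype)
  have hΨ : ∀ v p, Ψ v p = B v (w p.1) p.2 := fun v p => rfl
  have h1 := LinearMap.finrank_range_add_finrank_ker Ψ
  have h2 : finrank F R ≤ finrank F (LinearMap.ker Ψ) := by
    rw [← Submodule.finrank_map_subtype_eq T (LinearMap.ker Ψ)]
    refine Submodule.finrank_mono fun v hv => ?_
    obtain ⟨hvT, hv0⟩ := (hR v).1 hv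
    refine ⟨⟨v, hvT⟩, ?_, rfl⟩
    refine LinearMap.mem_ker.2 (funext fun p => ?_)
    rw [hΨ]
    exact congrFun (hv0 _ (hw p.1)) p.2
  have h3 : finrank F (Submodule.span F (Set.range fun b => fun p : β × Φ => B (w b) (w p.1) p.2))
      ≤ finrank F (LinearMap.range Ψ) := by
    refine Submodule.finrank_mono (Submodule.span_le.2 ?_)
    rintro _ ⟨b, rfl⟩
    exact ⟨⟨w b, hw b⟩, rfl⟩
  omega

theorem finrank_span_bilin_add {V β Φ : Type*} [AddCommGroup V] [Module F V]
    [FiniteDimensional F V] [Finite β]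
    (T R : Submodule F V) (B : V →ₗ[F] V →ₗ[F] (Φ → F))
    (hR : ∀ v, v ∈ R ↔ v ∈ T ∧ ∀ w ∈ T, B v w = 0) (w : β → V)
    (hw : Submodule.span F (Set.range w) = T) :
    finrank F (Submodule.span F (Set.range fun b => fun p : β × Φ => B (w b) (w p.1) p.2))
      + finrank F R = finrank F T := by
  have hwT : ∀ b, w b ∈ T := fun b => hw ▸ Submodule.subset_span ⟨b, rfl⟩
  refine le_antisymm (finrank_span_bilin_add_le T R B hR w hwT) ?_
  let Ψ : V →ₗ[F] (β × Φ → F) :=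
    LinearMap.pi fun p => (LinearMap.proj p.2).comp (B.flip (w p.1))
  have hΨ : ∀ v p, Ψ v p = B v (w p.1) p.2 := fun v p => rfl
  have h1 := LinearMap.finrank_range_add_finrank_ker (Ψ.domRestrict T)
  have h2 : finrank F (LinearMap.ker (Ψ.domRestrict T)) ≤ finrank F R := by
    rw [← Submodule.finrank_map_subtype_eq T (LinearMap.ker _)]
    refine Submodule.finrank_mono ?_
    rintro _ ⟨v, hv, rfl⟩
    refine (hR _).2 ⟨v.2, fun u hu => ?_⟩
    rw [← hw] at hu
    induction hu using Submodule.span_induction with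
    | mem x hx =>
      obtain ⟨b, rfl⟩ := hx
      funext φ
      exact congrFun (LinearMap.mem_ker.1 hv) (b, φ)
    | zero => simp
    | add x y _ _ hx hy => rw [map_add, hx, hy, add_zero]
    | smul c x _ hx => rw [map_smul, hx, smul_zero]
  have h3 : LinearMap.range (Ψ.domRestrict T) =
      Submodule.span F (Set.range fun b => fun p : β × Φ => B (w b) (w p.1) p.2) := by
    rw [LinearMap.range_domRestrict, ← hw, Submodule.map_span, ← Set.range_comp]
    rfl
  rw [h3] at h1
  omega

end LinearAlgebra

open MvPolynomial

/-! ### Polynomial families of vectors, conormal spaces and Gauss kernels over extension fields -/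

noncomputable section Polynomials

variable {K : Type*} [Field K] {L : Type*} [Field L] [Algebra K L]
  {L' : Type*} [Field L'] [Algebra K L'] {ι : Type*}

variable (K) in
/-- The ideal of algebraic relations of a tuple. -/
def relIdeal (η : ι → L) : Ideal (MvPolynomial ι K) :=
  RingHom.ker (aeval η : MvPolynomial ι K →ₐ[K] L)

theorem mem_relIdeal {η : ι → L} {f : MvPolynomial ι K} : f ∈ relIdeal K η ↔ aeval η f = 0 :=
  RingHom.mem_ker

/-- The gradient of a polynomial at a point with coordinates in an extension field. -/
def grad (f : MvPolynomial ι K) (η : ι → L) : ι → L := fun i => aeval η (pderiv i f)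

/-- The span of the values at `z` of a family of vectors with polynomial entries. -/
def valSpan {J κ : Type*} (a : J → κ → MvPolynomial ι K) (z : ι → L) : Submodule L (κ → L) :=
  Submodule.span L (Set.range fun j k => aeval z (a j k))

instance {J κ : Type*} [Finite J] (a : J → κ → MvPolynomial ι K) (z : ι → L) :
    Module.Finite L (valSpan a z) :=
  FiniteDimensional.span_of_finite L (Set.finite_range _)

theorem aeval_det_of {m : ℕ} {κ : Type*} (a : Fin m → κ → MvPolynomial ι K) (c : Fin m → κ)
    (z : ι → L) : aeval z (Matrix.of fun i j => a i (c j)).det =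
      (Matrix.of fun i j => aeval z (a i (c j))).det := by
  rw [AlgHom.map_det]
  rfl

/-- Linear independence is an open condition. -/
theorem exists_forall_linearIndependent {m : ℕ} {κ : Type*} (a : Fin m → κ → MvPolynomial ι K)
    (z : ι → L) (h : LinearIndependent L fun j k => aeval z (a j k)) :
    ∃ p : MvPolynomial ι K, aeval z p ≠ 0 ∧
      ∀ z' : ι → L', aeval z' p ≠ 0 → LinearIndependent L' fun j k => aeval z' (a j k) := by
  obtain ⟨c, hc⟩ := (linearIndependent_iff_exists_minor _).1 h
  refine ⟨(Matrix.of fun i j => a i (c j)).det, by rwa [aeval_det_of], fun z' hz' => ?_⟩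
  rw [aeval_det_of] at hz'
  exact (linearIndependent_iff_exists_minor _).2 ⟨c, hz'⟩

/-- The hypothesis `hz` says that `z` is a specialization of `η`; a minor that is nonzero at `z`
cannot vanish at `η`. -/
theorem linearIndependent_of_relIdeal_le {m : ℕ} {κ : Type*} (a : Fin m → κ → MvPolynomial ι K)
    {η : ι → L} {z : ι → L'} (hz : relIdeal K η ≤ relIdeal K z)
    (h : LinearIndependent L' fun j k => aeval z (a j k)) :
    LinearIndependent L fun j k => aeval η (a j k) := by
  obtain ⟨p, hp, hp'⟩ := exists_forall_linearIndependent (L' := L) a z h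
  exact hp' η fun h0 => hp (mem_relIdeal.1 (hz (mem_relIdeal.2 h0)))

/-- Lower semicontinuity of the rank. -/
theorem exists_forall_finrank_valSpan_le {J κ : Type*} (a : J → κ → MvPolynomial ι K) (z : ι → L)
    [Module.Finite L (valSpan a z)] (hfin : ∀ z' : ι → L', Module.Finite L' (valSpan a z')) :
    ∃ p : MvPolynomial ι K, aeval z p ≠ 0 ∧
      ∀ z' : ι → L', aeval z' p ≠ 0 → finrank L (valSpan a z) ≤ finrank L' (valSpan a z') := by
  have : Module.Finite L (Submodule.span L (Set.range fun j k => aeval z (a j k))) :=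
    inferInstanceAs (Module.Finite L (valSpan a z))
  obtain ⟨b, hb, -⟩ := exists_linearIndependent_comp (F := L) fun j k => aeval z (a j k)
  obtain ⟨p, hp, hp'⟩ := exists_forall_linearIndependent (L' := L') (fun i => a (b i)) z hb
  refine ⟨p, hp, fun z' hz' => ?_⟩
  have := hfin z'
  exact le_finrank_of_linearIndependent (hp' z' hz') fun i => Submodule.subset_span ⟨b i, rfl⟩

theorem finrank_valSpan_le {J κ : Type*} (a : J → κ → MvPolynomial ι K) {η : ι → L} {z : ι → L'}
    [Module.Finite L' (valSpan a z)] (hfin : ∀ η : ι → L, Module.Finite L (valSpan a η))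
    (hz : relIdeal K η ≤ relIdeal K z) :
    finrank L' (valSpan a z) ≤ finrank L (valSpan a η) := by
  obtain ⟨p, hp, hp'⟩ := exists_forall_finrank_valSpan_le (L' := L) a z hfin
  exact hp' η fun h0 => hp (mem_relIdeal.1 (hz (mem_relIdeal.2 h0)))

/-- Membership in the span of a family of polynomial vectors is preserved by specializations that
do not lower the rank. -/
theorem mem_valSpan_of_relIdeal_le {J κ : Type*} [Finite κ] (a : J → κ → MvPolynomial ι K)
    (b : κ → MvPolynomial ι K) {η : ι → L} {z : ι → L'} (hz : relIdeal K η ≤ relIdeal K z)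
    (hr : finrank L (valSpan a η) ≤ finrank L' (valSpan a z))
    (hb : (fun k => aeval η (b k)) ∈ valSpan a η) :
    (fun k => aeval z (b k)) ∈ valSpan a z := by
  have : Fintype κ := Fintype.ofFinite κ
  by_contra hcon
  obtain ⟨e, he, hspan⟩ := exists_linearIndependent_comp (F := L') fun j k => aeval z (a j k)
  -- If `b` left the span at `z`, adjoining it to a basis would give one independent vector too
  -- many; lifted to `η` they would lie in a span of too small a rank.
  have h1 : LinearIndependent L' (Fin.cons (fun k => aeval z (b k))
      ((fun j k => aeval z (a j k)) ∘ e)) := by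
    refine linearIndependent_finCons.2 ⟨he, ?_⟩
    rw [hspan]
    exact hcon
  have h2 := linearIndependent_of_relIdeal_le (L := L)
    (Fin.cons b (a ∘ e) : Fin _ → κ → MvPolynomial ι K) hz (by
      convert h1 using 2 with i
      refine Fin.cases ?_ (fun i => ?_) i <;> simp)
  have h3 := le_finrank_of_linearIndependent (S := valSpan a η) h2 fun i => by
    refine Fin.cases ?_ (fun i => ?_) i
    · simpa using hb
    · exact Submodule.subset_span ⟨e i, rfl⟩
  have h4 : finrank L' (valSpan a z) + 1 ≤ finrank L (valSpan a η) := h3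
  omega

/-- The span of the gradients at `η` of the elements of `I`. -/
def conormal (I : Ideal (MvPolynomial ι K)) (η : ι → L) : Submodule L (ι → L) :=
  valSpan (fun (f : I) i => pderiv i (f : MvPolynomial ι K)) η

theorem grad_mem_conormal {I : Ideal (MvPolynomial ι K)} {f : MvPolynomial ι K} (hf : f ∈ I)
    (η : ι → L) : grad f η ∈ conormal I η :=
  Submodule.subset_span ⟨⟨f, hf⟩, rfl⟩

theorem conormal_le {I : Ideal (MvPolynomial ι K)} {η : ι → L} {S : Submodule L (ι → L)} :
    conormal I η ≤ S ↔ ∀ f ∈ I, grad f η ∈ S := by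
  refine Submodule.span_le.trans ⟨fun h f hf => h ⟨⟨f, hf⟩, rfl⟩, ?_⟩
  rintro h _ ⟨f, rfl⟩
  exact h f f.2

theorem finrank_conormal_le [Finite ι] {I : Ideal (MvPolynomial ι K)} {η : ι → L} {z : ι → L'}
    (hz : relIdeal K η ≤ relIdeal K z) : finrank L' (conormal I z) ≤ finrank L (conormal I η) := by
  have : Module.Finite L' (valSpan (fun (f : I) i => pderiv i (f : MvPolynomial ι K)) z) :=
    FiniteDimensional.finiteDimensional_submodule _
  exact finrank_valSpan_le _ (fun _ => FiniteDimensional.finiteDimensional_submodule _) hz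

theorem exists_forall_finrank_conormal_le [Finite ι] (I : Ideal (MvPolynomial ι K)) (z : ι → L) :
    ∃ p : MvPolynomial ι K, aeval z p ≠ 0 ∧ ∀ z' : ι → L', aeval z' p ≠ 0 →
      finrank L (conormal I z) ≤ finrank L' (conormal I z') := by
  have : Module.Finite L (valSpan (fun (f : I) i => pderiv i (f : MvPolynomial ι K)) z) :=
    FiniteDimensional.finiteDimensional_submodule _
  exact exists_forall_finrank_valSpan_le _ z
    (fun _ => FiniteDimensional.finiteDimensional_submodule _)

theorem exists_basis_conormal [Finite ι] (I : Ideal (MvPolynomial ι K)) (η : ι → L) :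
    ∃ g : Fin (finrank L (conormal I η)) → I,
      LinearIndependent L (fun j => grad (g j : MvPolynomial ι K) η) ∧
      Submodule.span L (Set.range fun j => grad (g j : MvPolynomial ι K) η) = conormal I η :=
  exists_linearIndependent_comp fun (f : I) => grad (f : MvPolynomial ι K) η

theorem exists_sum_of_mem_conormal {I : Ideal (MvPolynomial ι K)} {η v : ι → L}
    (hv : v ∈ conormal I η) : ∃ (m : ℕ) (c : Fin m → L) (g : Fin m → MvPolynomial ι K),
      (∀ j, g j ∈ I) ∧ v = ∑ j, c j • grad (g j) η := by
  obtain ⟨m, c, g, h⟩ := (Submodule.mem_span_set' (R := L)).1 hv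
  choose f hf using fun j => (g j).2
  refine ⟨m, c, fun j => f j, fun j => (f j).2, ?_⟩
  rw [← h]
  refine Finset.sum_congr rfl fun j _ => ?_
  rw [← hf j]
  rfl

theorem pderiv_comm (i j : ι) (f : MvPolynomial ι K) :
    pderiv i (pderiv j f) = pderiv j (pderiv i f) := by
  classical
  have : ⁅(pderiv i : Derivation K (MvPolynomial ι K) (MvPolynomial ι K)),
      (pderiv j : Derivation K (MvPolynomial ι K) (MvPolynomial ι K))⁆ = 0 := by
    refine MvPolynomial.derivation_ext fun k => ?_
    simp only [Derivation.commutator_apply, pderiv_X, Derivation.zero_apply, Pi.single_apply]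
    split_ifs <;> simp
  have h := congrArg (fun D => D f) this
  rw [Derivation.commutator_apply, Derivation.zero_apply, sub_eq_zero] at h
  exact h

variable [Fintype ι]

/-- The common kernel at `η` of the differentials of the elements of `I`. -/
def tangent (I : Ideal (MvPolynomial ι K)) (η : ι → L) : Submodule L (ι → L) :=
  dotAnn (conormal I η)

theorem mem_tangent {I : Ideal (MvPolynomial ι K)} {η v : ι → L} :
    v ∈ tangent I η ↔ ∀ f ∈ I, grad f η ⬝ᵥ v = 0 := by
  refine mem_dotAnn_span.trans ⟨fun h f hf => ?_, ?_⟩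
  · rw [dotProduct_comm]; exact h _ ⟨⟨f, hf⟩, rfl⟩
  · rintro h _ ⟨f, rfl⟩
    rw [dotProduct_comm]
    exact h f f.2

theorem dotAnn_tangent (I : Ideal (MvPolynomial ι K)) (η : ι → L) :
    dotAnn (tangent I η) = conormal I η := dotAnn_dotAnn _

theorem finrank_tangent_add (I : Ideal (MvPolynomial ι K)) (η : ι → L) :
    finrank L (tangent I η) + finrank L (conormal I η) = Fintype.card ι :=
  finrank_dotAnn_add _

/-- The Hessian of `f` at `η`, applied to `v`. -/
def hess (f : MvPolynomial ι K) (η v : ι → L) : ι → L :=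
  fun j => ∑ i, aeval η (pderiv i (pderiv j f)) * v i

theorem hess_dotProduct_comm (f : MvPolynomial ι K) (η v w : ι → L) :
    hess f η v ⬝ᵥ w = hess f η w ⬝ᵥ v := by
  simp only [hess, dotProduct, Finset.sum_mul]
  rw [Finset.sum_comm]
  refine Finset.sum_congr rfl fun i _ => Finset.sum_congr rfl fun j _ => ?_
  rw [pderiv_comm]
  ring

/-- The second fundamental form, with values in functions on `I`. -/
def hessBilin (I : Ideal (MvPolynomial ι K)) (η : ι → L) :
    (ι → L) →ₗ[L] (ι → L) →ₗ[L] (I → L) :=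
  LinearMap.mk₂ L (fun v w f => hess (f : MvPolynomial ι K) η v ⬝ᵥ w)
    (fun v v' w => by
      funext f
      simp [hess, mul_add, Finset.sum_add_distrib, dotProduct, add_mul])
    (fun c v w => by
      funext f
      simp only [hess, dotProduct, Pi.smul_apply, smul_eq_mul, Finset.mul_sum, Finset.sum_mul]
      exact Finset.sum_congr rfl fun i _ => Finset.sum_congr rfl fun j _ => by ring)
    (fun v w w' => by
      funext f
      simp [dotProduct_add])
    (fun c v w => by
      funext f
      simp [dotProduct_smul])

theorem hessBilin_apply (I : Ideal (MvPolynomial ι K)) (η v w : ι → L) (f : I) :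
    hessBilin I η v w f = hess (f : MvPolynomial ι K) η v ⬝ᵥ w := rfl

/-- The kernel at `η` of the differential of the Gauss map. -/
def gaussKer (I : Ideal (MvPolynomial ι K)) (η : ι → L) : Submodule L (ι → L) where
  carrier := {v | v ∈ tangent I η ∧ ∀ w ∈ tangent I η, hessBilin I η v w = 0}
  zero_mem' := ⟨zero_mem _, fun w _ => by simp⟩
  add_mem' := fun ha hb => ⟨add_mem ha.1 hb.1, fun w hw => by
    rw [map_add, LinearMap.add_apply, ha.2 w hw, hb.2 w hw, add_zero]⟩
  smul_mem' := fun c _ ha => ⟨Submodule.smul_mem _ c ha.1, fun w hw => by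
    rw [map_smul, LinearMap.smul_apply, ha.2 w hw, smul_zero]⟩

theorem mem_gaussKer {I : Ideal (MvPolynomial ι K)} {η v : ι → L} :
    v ∈ gaussKer I η ↔ v ∈ tangent I η ∧ ∀ w ∈ tangent I η, hessBilin I η v w = 0 := Iff.rfl

/-- The condition becomes membership in a span of gradients, a form that behaves well under
specialization and rescaling. -/
theorem mem_gaussKer_iff_hess_mem {I : Ideal (MvPolynomial ι K)} {η v : ι → L} :
    v ∈ gaussKer I η ↔ v ∈ tangent I η ∧ ∀ f ∈ I, hess f η v ∈ conormal I η := by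
  rw [mem_gaussKer, ← dotAnn_tangent]
  refine and_congr_right fun _ => ⟨fun h f hf w hw => congrFun (h w hw) ⟨f, hf⟩, fun h w hw => ?_⟩
  exact funext fun f => h f f.2 w hw

theorem gaussKer_le_tangent (I : Ideal (MvPolynomial ι K)) (η : ι → L) :
    gaussKer I η ≤ tangent I η := fun _ h => h.1

theorem derivation_aeval (D : Derivation K L L) (η : ι → L) (f : MvPolynomial ι K) :
    D (aeval η f) = grad f η ⬝ᵥ fun i => D (η i) := by
  classical
  induction f using MvPolynomial.induction_on with
  | C a => simp [grad, dotProduct]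
  | add p q hp hq => simp only [grad, map_add, hp, hq, dotProduct, add_mul, Finset.sum_add_distrib]
  | mul_X p i hp =>
    simp only [grad, map_mul, aeval_X, Derivation.leibniz, hp, dotProduct, smul_eq_mul, map_add,
      pderiv_X, add_mul, Finset.sum_add_distrib, Finset.mul_sum]
    congr 1
    · simp [Pi.single_apply]
    · exact Finset.sum_congr rfl fun j _ => by ring

theorem derivation_grad (D : Derivation K L L) (η : ι → L) (f : MvPolynomial ι K) :
    (fun i => D (grad f η i)) = hess f η fun i => D (η i) := by
  funext j
  rw [grad, derivation_aeval]
  rfl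

theorem derivation_dotProduct (D : Derivation K L L) (v w : ι → L) :
    D (v ⬝ᵥ w) = v ⬝ᵥ (fun i => D (w i)) + (fun i => D (v i)) ⬝ᵥ w := by
  simp only [dotProduct, map_sum, Derivation.leibniz, smul_eq_mul, Finset.sum_add_distrib]
  congr 1
  exact Finset.sum_congr rfl fun i _ => mul_comm _ _

end Polynomials

/-! ### Semicontinuity of the rank of the Gauss map -/

noncomputable section GaussRank

variable {K : Type*} [Field K] {L : Type*} [Field L] [Algebra K L]
  {L' : Type*} [Field L'] [Algebra K L'] {ι : Type*} [Fintype ι]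

/-- A tangent vector at a smooth point extends to a polynomial vector field. -/
theorem exists_tangent_extension {I : Ideal (MvPolynomial ι K)} {η : ι → L} {z : ι → K}
    (hz : relIdeal K η ≤ relIdeal K z) (hr : finrank L (conormal I η) ≤ finrank K (conormal I z))
    {v : ι → K} (hv : v ∈ tangent I z) :
    ∃ w : ι → MvPolynomial ι K, (∀ i, aeval z (w i) = v i) ∧
      (fun i => aeval η (w i)) ∈ tangent I η := by
  classical
  obtain ⟨g, hg, hspan⟩ := exists_basis_conormal I z
  obtain ⟨c, hc⟩ := (linearIndependent_iff_exists_minor _).1 hg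
  generalize finrank K (conormal I z) = m at *
  let P : Matrix (Fin m) (Fin m) (MvPolynomial ι K) :=
    Matrix.of fun i j => pderiv (c j) (g i : MvPolynomial ι K)
  have hP : aeval z P.det = (Matrix.of fun i j => grad (g i : MvPolynomial ι K) z (c j)).det :=
    aeval_det_of (fun i k => pderiv k (g i : MvPolynomial ι K)) c z
  let y : Fin m → MvPolynomial ι K := fun j => ∑ i, pderiv i (g j : MvPolynomial ι K) * C (v i)
  have hy : ∀ j, aeval z (y j) = 0 := fun j => by
    have := mem_tangent.1 hv (g j) (g j).2
    simpa [y, dotProduct, grad] using this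
  -- Cramer's rule: `det P • v` is corrected in the coordinates `c j` so that it is killed
  -- identically by the gradients of the `g j`. The correction vanishes at `z` because `v` is
  -- tangent there, and dividing by `det P (z)` restores the value `v`.
  let u := P.adjugate.mulVec y
  have hu0 : ∀ j, aeval z (u j) = 0 := fun j => by
    simp only [u, Matrix.mulVec, dotProduct, map_sum, map_mul, hy, mul_zero,
      Finset.sum_const_zero]
  have hPu : P.mulVec u = P.det • y := by
    rw [Matrix.mulVec_mulVec, Matrix.mul_adjugate, Matrix.smul_mulVec, Matrix.one_mulVec]
  let w : ι → MvPolynomial ι K := fun i => P.det * C (v i) - ∑ j, if c j = i then u j else 0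
  have hgw : ∀ r, ∑ i, pderiv i (g r : MvPolynomial ι K) * w i = 0 := fun r => by
    have h1 : ∑ i, pderiv i (g r : MvPolynomial ι K) * (P.det * C (v i)) = P.det * y r := by
      rw [Finset.mul_sum]
      exact Finset.sum_congr rfl fun i _ => by ring
    have h2 : ∑ i, pderiv i (g r : MvPolynomial ι K) * (∑ j, if c j = i then u j else 0) =
        P.mulVec u r := by
      simp only [Finset.mul_sum, mul_ite, mul_zero]
      rw [Finset.sum_comm]
      exact Finset.sum_congr rfl fun j _ => by simp [P]
    simp only [w, mul_sub, Finset.sum_sub_distrib]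
    rw [h1, h2, hPu, Pi.smul_apply, smul_eq_mul, sub_self]
  set δ := aeval z P.det with hδ
  have hδ0 : δ ≠ 0 := by rw [hP]; exact hc
  refine ⟨fun i => C δ⁻¹ * w i, fun i => ?_, ?_⟩
  · have : ∑ j, (aeval z (if c j = i then u j else 0) : K) = 0 :=
      Finset.sum_eq_zero fun j _ => by split_ifs <;> simp [hu0]
    simp only [map_mul, w, map_sub, map_sum, this, sub_zero]
    rw [← hδ]
    simp only [aeval_C, Algebra.algebraMap_self, RingHom.id_apply]
    rw [← mul_assoc, inv_mul_cancel₀ hδ0, one_mul]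
  · have hli : LinearIndependent L fun j => grad (g j : MvPolynomial ι K) η :=
      linearIndependent_of_relIdeal_le (fun j k => pderiv k (g j : MvPolynomial ι K)) hz hg
    have hsp : Submodule.span L (Set.range fun j => grad (g j : MvPolynomial ι K) η) =
        conormal I η := by
      refine Submodule.eq_of_le_of_finrank_le (Submodule.span_le.2 ?_) ?_
      · rintro _ ⟨j, rfl⟩
        exact grad_mem_conormal (g j).2 η
      · rw [finrank_span_eq_card hli, Fintype.card_fin]
        exact hr
    rw [tangent, ← hsp, mem_dotAnn_span]
    rintro _ ⟨r, rfl⟩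
    have := congrArg (aeval η) (hgw r)
    simp only [map_sum, map_mul, map_zero] at this
    simp only [dotProduct, grad, map_mul, mul_assoc, ← Finset.mul_sum]
    rw [mul_eq_zero]
    right
    rw [← this]
    exact Finset.sum_congr rfl fun i _ => mul_comm _ _

/-- Tangency of a polynomial field at `η` is a set of algebraic relations of `η`, so it passes to
every specialization. -/
theorem aeval_mem_tangent {I : Ideal (MvPolynomial ι K)} {η : ι → L} {z : ι → L'}
    (hz : relIdeal K η ≤ relIdeal K z) {w : ι → MvPolynomial ι K}
    (hw : (fun i => aeval η (w i)) ∈ tangent I η) : (fun i => aeval z (w i)) ∈ tangent I z := by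
  rw [mem_tangent] at hw ⊢
  intro f hf
  have h : ∑ i, pderiv i f * w i ∈ relIdeal K η := by
    rw [mem_relIdeal, map_sum, ← hw f hf]
    simp [dotProduct, grad]
  have := mem_relIdeal.1 (hz h)
  rw [map_sum] at this
  simpa [dotProduct, grad] using this

/-- The coefficients of the second fundamental form in terms of polynomial vector fields. -/
def secondForm {β : Type*} (I : Ideal (MvPolynomial ι K)) (w : β → ι → MvPolynomial ι K) :
    β → β × I → MvPolynomial ι K :=
  fun b p => ∑ j, (∑ i, pderiv i (pderiv j (p.2 : MvPolynomial ι K)) * w b i) * w p.1 j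

theorem aeval_secondForm {β : Type*} (I : Ideal (MvPolynomial ι K)) (w : β → ι → MvPolynomial ι K)
    (z : ι → L) (b : β) (p : β × I) : aeval z (secondForm I w b p) =
      hessBilin I z (fun i => aeval z (w b i)) (fun i => aeval z (w p.1 i)) p.2 := by
  simp [secondForm, hessBilin_apply, hess, dotProduct]

theorem finrank_secondForm_add_le {β : Type*} [Finite β] (I : Ideal (MvPolynomial ι K))
    (w : β → ι → MvPolynomial ι K) (z : ι → L)
    (hw : ∀ b, (fun i => aeval z (w b i)) ∈ tangent I z) :
    finrank L (valSpan (secondForm I w) z) + finrank L (gaussKer I z) ≤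
      finrank L (tangent I z) := by
  have h : (fun b p => aeval z (secondForm I w b p)) = fun b (p : β × I) =>
      hessBilin I z (fun i => aeval z (w b i)) (fun i => aeval z (w p.1 i)) p.2 :=
    funext fun b => funext fun p => aeval_secondForm I w z b p
  rw [valSpan, h]
  exact finrank_span_bilin_add_le (tangent I z) (gaussKer I z) (hessBilin I z)
      (fun v => mem_gaussKer) _ hw

theorem finrank_secondForm_add {β : Type*} [Finite β] (I : Ideal (MvPolynomial ι K))
    (w : β → ι → MvPolynomial ι K) (z : ι → L)
    (hw : Submodule.span L (Set.range fun b i => aeval z (w b i)) = tangent I z) :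
    finrank L (valSpan (secondForm I w) z) + finrank L (gaussKer I z) =
      finrank L (tangent I z) := by
  have h : (fun b p => aeval z (secondForm I w b p)) = fun b (p : β × I) =>
      hessBilin I z (fun i => aeval z (w b i)) (fun i => aeval z (w p.1 i)) p.2 :=
    funext fun b => funext fun p => aeval_secondForm I w z b p
  rw [valSpan, h]
  exact finrank_span_bilin_add (tangent I z) (gaussKer I z) (hessBilin I z)
      (fun v => mem_gaussKer) _ hw

theorem finrank_tangent_eq_of_finrank_conormal_eq {I : Ideal (MvPolynomial ι K)} {η : ι → L}
    {z : ι → L'} (h : finrank L (conormal I η) = finrank L' (conormal I z)) :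
    finrank L (tangent I η) = finrank L' (tangent I z) := by
  have h1 := finrank_tangent_add I η
  have h2 := finrank_tangent_add I z
  omega

/-- Extensions of a basis of the tangent space at `z` remain independent at `η`, and the two tangent
spaces have the same dimension. Such a frame makes the second fundamental form a matrix of
polynomials. -/
theorem exists_tangent_frame {I : Ideal (MvPolynomial ι K)} {η : ι → L} {z : ι → K}
    (hz : relIdeal K η ≤ relIdeal K z) (hr : finrank L (conormal I η) = finrank K (conormal I z)) :
    ∃ w : Fin (finrank K (tangent I z)) → ι → MvPolynomial ι K,
      Submodule.span K (Set.range fun b i => aeval z (w b i)) = tangent I z ∧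
      Submodule.span L (Set.range fun b i => aeval η (w b i)) = tangent I η := by
  let B := Module.finBasis K (tangent I z)
  choose w hwz hwη using fun b => exists_tangent_extension hz hr.le (B b).2
  have hwz' : (fun b i => aeval z (w b i)) = fun b => (B b : ι → K) :=
    funext fun b => funext fun i => hwz b i
  have hli : LinearIndependent K fun b => (B b : ι → K) :=
    B.linearIndependent.map' (tangent I z).subtype (Submodule.ker_subtype _)
  refine ⟨w, ?_, ?_⟩
  · rw [hwz']
    have := congrArg (Submodule.map (tangent I z).subtype) B.span_eq
    rw [Submodule.map_span, ← Set.range_comp, Submodule.map_top, Submodule.range_subtype] at this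
    exact this
  · have hliη := linearIndependent_of_relIdeal_le w hz (by rw [hwz']; exact hli)
    refine Submodule.eq_of_le_of_finrank_le (Submodule.span_le.2 ?_) ?_
    · rintro _ ⟨b, rfl⟩
      exact hwη b
    · rw [finrank_span_eq_card hliη, Fintype.card_fin]
      exact (finrank_tangent_eq_of_finrank_conormal_eq hr).le

/-- The rank of the Gauss map at a smooth point is at most the generic rank. -/
theorem finrank_gaussKer_le {I : Ideal (MvPolynomial ι K)} {η : ι → L} {z : ι → K}
    (hz : relIdeal K η ≤ relIdeal K z) (hr : finrank L (conormal I η) = finrank K (conormal I z)) :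
    finrank L (gaussKer I η) ≤ finrank K (gaussKer I z) := by
  obtain ⟨w, hwz, hwη⟩ := exists_tangent_frame hz hr
  have h1 := finrank_secondForm_add I w z hwz
  have h2 := finrank_secondForm_add I w η hwη
  have h3 := finrank_valSpan_le (L := L) (secondForm I w) (fun _ => inferInstance) hz
  have h4 := finrank_tangent_eq_of_finrank_conormal_eq hr
  omega

/-- Having the generic Gauss kernel dimension is an open condition on smooth points. The first part
supplies a polynomial nonzero at the generic point, for density; the second one nonzero at a given
regular point, for openness. -/
theorem exists_forall_finrank_gaussKer_eq {I : Ideal (MvPolynomial ι K)} {η : ι → L} {z : ι → K}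
    (hz : relIdeal K η ≤ relIdeal K z) (hr : finrank L (conormal I η) = finrank K (conormal I z)) :
    (∃ p : MvPolynomial ι K, aeval η p ≠ 0 ∧ ∀ z' : ι → K, relIdeal K η ≤ relIdeal K z' →
      finrank L (conormal I η) = finrank K (conormal I z') → aeval z' p ≠ 0 →
      finrank K (gaussKer I z') = finrank L (gaussKer I η)) ∧
    (finrank K (gaussKer I z) = finrank L (gaussKer I η) →
    ∃ p : MvPolynomial ι K, aeval z p ≠ 0 ∧ ∀ z' : ι → K, relIdeal K η ≤ relIdeal K z' →
      finrank L (conormal I η) = finrank K (conormal I z') → aeval z' p ≠ 0 →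
      finrank K (gaussKer I z') = finrank L (gaussKer I η)) := by
  obtain ⟨w, hwz, hwη⟩ := exists_tangent_frame hz hr
  have h1 := finrank_secondForm_add I w z hwz
  have h2 := finrank_secondForm_add I w η hwη
  have h4 := finrank_tangent_eq_of_finrank_conormal_eq hr
  -- At `z'` the frame may fail to span, so only an inequality is available there; semicontinuity
  -- supplies the opposite one.
  have key : ∀ z' : ι → K, relIdeal K η ≤ relIdeal K z' →
      finrank L (conormal I η) = finrank K (conormal I z') →
      finrank L (valSpan (secondForm I w) η) ≤ finrank K (valSpan (secondForm I w) z') →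
      finrank K (gaussKer I z') = finrank L (gaussKer I η) := by
    intro z' hz' hr' hle
    have h5 := finrank_gaussKer_le hz' hr'
    have h6 := finrank_secondForm_add_le I w z' fun b =>
      aeval_mem_tangent hz' (hwη ▸ Submodule.subset_span ⟨b, rfl⟩)
    have h7 := finrank_tangent_eq_of_finrank_conormal_eq hr'
    omega
  constructor
  · obtain ⟨p, hp, hp'⟩ := exists_forall_finrank_valSpan_le (L' := K) (secondForm I w) η
      fun _ => inferInstance
    exact ⟨p, hp, fun z' hz' hr' h => key z' hz' hr' (hp' z' h)⟩
  · intro heq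
    obtain ⟨p, hp, hp'⟩ := exists_forall_finrank_valSpan_le (L' := K) (secondForm I w) z
      fun _ => inferInstance
    refine ⟨p, hp, fun z' hz' hr' h => key z' hz' hr' (le_trans ?_ (hp' z' h))⟩
    omega

end GaussRank

/-! ### Derivations, tangent vectors at generic points, transcendence degree -/

noncomputable section Derivations

variable {K : Type*} [Field K] {L : Type*} [Field L] [Algebra K L]

/-- Formal smoothness kills the first cotangent homology, so `L ⊗ Ω[A⁄K] → Ω[L⁄K]` is injective;
over the field `L` it has a left inverse, along which the functional defined by `d` extends. -/
theorem exists_derivation_extension {A : Type*} [CommRing A] [Algebra K A] [Algebra A L]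
    [IsScalarTower K A L] [Algebra.FormallySmooth A L] (d : Derivation K A L) :
    ∃ D : Derivation K L L, ∀ a, D (algebraMap A L a) = d a := by
  have hinj : Function.Injective (KaehlerDifferential.mapBaseChange K A L) := by
    rw [← LinearMap.ker_eq_bot, eq_bot_iff]
    intro y hy
    obtain ⟨c, rfl⟩ := (Algebra.H1Cotangent.exact_δ_mapBaseChange K A L y).1 hy
    rw [Subsingleton.elim c 0, map_zero]
    exact zero_mem _
  obtain ⟨ψ, hψ⟩ := LinearMap.exists_leftInverse_of_injective _ (LinearMap.ker_eq_bot.2 hinj)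
  let φ : TensorProduct A L (Ω[A⁄K]) →ₗ[L] L := LinearMap.liftBaseChange L d.liftKaehlerDifferential
  refine ⟨(φ ∘ₗ ψ).compDer (KaehlerDifferential.D K L), fun a => ?_⟩
  have h1 : KaehlerDifferential.D K L (algebraMap A L a) =
      KaehlerDifferential.mapBaseChange K A L (1 ⊗ₜ KaehlerDifferential.D K A a) := by
    rw [KaehlerDifferential.mapBaseChange_tmul, one_smul, KaehlerDifferential.map_D]
  have h2 := LinearMap.congr_fun hψ (1 ⊗ₜ KaehlerDifferential.D K A a)
  simp only [LinearMap.comp_apply, LinearMap.id_apply] at h2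
  change φ (ψ (KaehlerDifferential.D K L (algebraMap A L a))) = d a
  rw [h1, h2, LinearMap.liftBaseChange_tmul, one_smul, Derivation.liftKaehlerDifferential_comp_D]

open scoped IntermediateField.algebraAdjoinAdjoin in
-- The extension is a localization followed by a finitely generated field extension, and the latter
-- is formally smooth in characteristic 0.
theorem formallySmooth_adjoin [CharZero K] [Algebra.EssFiniteType K L] (s : Set L) :
    Algebra.FormallySmooth (Algebra.adjoin K s) L := by
  have : CharZero L := charZero_of_injective_algebraMap (algebraMap K L).injective
  have h1 : Algebra.FormallySmooth (Algebra.adjoin K s) (IntermediateField.adjoin K s) :=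
    .of_isLocalization (nonZeroDivisors _)
  have : CharZero (IntermediateField.adjoin K s) :=
    charZero_of_injective_algebraMap (algebraMap K _).injective
  have : Algebra.EssFiniteType (IntermediateField.adjoin K s) L := .of_comp K _ _
  have h2 : Algebra.FormallySmooth (IntermediateField.adjoin K s) L := inferInstance
  exact .comp _ (IntermediateField.adjoin K s) _

/-- The field of constants of a derivation. -/
def constField (D : Derivation K L L) : IntermediateField K L where
  carrier := {y | D y = 0}
  mul_mem' {a b} ha hb := by
    change D (a * b) = 0
    rw [Derivation.leibniz, show D a = 0 from ha, show D b = 0 from hb, smul_zero, smul_zero,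
      add_zero]
  add_mem' {a b} ha hb := by
    change D (a + b) = 0
    rw [map_add, show D a = 0 from ha, show D b = 0 from hb, add_zero]
  algebraMap_mem' r := D.map_algebraMap r
  inv_mem' y hy := by
    change D y⁻¹ = 0
    rw [Derivation.leibniz_inv, show D y = 0 from hy, smul_zero]

/-- Differentiate the minimal polynomial of `y` over the field of constants: its derivative at `y`
is nonzero by separability. -/
theorem derivation_eq_zero_of_isAlgebraic [CharZero K] (D : Derivation K L L) {s : Set L}
    (hs : ∀ y ∈ s, D y = 0) {y : L} (hy : IsAlgebraic (Algebra.adjoin K s) y) : D y = 0 := by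
  set M := constField D
  have hle : Algebra.adjoin K s ≤ M.toSubalgebra := Algebra.adjoin_le hs
  have hyM : IsAlgebraic M y := IsAlgebraic.tower_top_of_subalgebra_le hle hy
  have : CharZero M := charZero_of_injective_algebraMap (algebraMap K M).injective
  let D' : Derivation M L L := Derivation.mk'
    { toFun := D
      map_add' := map_add D
      map_smul' := fun c x => by
        rw [Algebra.smul_def, Derivation.leibniz, show D (algebraMap M L c) = 0 from c.2, smul_zero,
          add_zero]
        rfl } (fun a b => D.leibniz a b)
  have h1 := D'.map_aeval (minpoly M y) y
  rw [minpoly.aeval, map_zero] at h1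
  have h2 := (minpoly.irreducible hyM.isIntegral).separable.aeval_derivative_ne_zero
    (minpoly.aeval M y)
  exact (smul_eq_zero.1 h1.symm).resolve_left h2

variable {ι : Type*} [Fintype ι]

theorem grad_mul_dotProduct (p q : MvPolynomial ι K) (η w : ι → L) :
    grad (p * q) η ⬝ᵥ w = aeval η p * (grad q η ⬝ᵥ w) + aeval η q * (grad p η ⬝ᵥ w) := by
  simp only [grad, dotProduct, Derivation.leibniz, map_add, smul_eq_mul, map_mul, add_mul,
    Finset.sum_add_distrib, Finset.mul_sum, mul_assoc]

theorem derivation_mem_tangent (D : Derivation K L L) (η : ι → L) :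
    (fun i => D (η i)) ∈ tangent (relIdeal K η) η :=
  mem_tangent.2 fun f hf => by rw [← derivation_aeval, mem_relIdeal.1 hf, map_zero]

/-- Tangent vectors at a generic point come from derivations. -/
theorem exists_derivation_of_mem_tangent [CharZero K] [Algebra.EssFiniteType K L] {η w : ι → L}
    (hw : w ∈ tangent (relIdeal K η) η) : ∃ D : Derivation K L L, ∀ i, D (η i) = w i := by
  classical
  rw [mem_tangent] at hw
  let A := Algebra.adjoin K (Set.range η)
  have hsurj : ∀ a : A, ∃ p : MvPolynomial ι K, aeval η p = a := fun a => by
    have h : (a : L) ∈ Algebra.adjoin K (Set.range η) := a.2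
    rw [Algebra.adjoin_range_eq_range_aeval] at h
    exact h
  choose g hg using hsurj
  have hgrad : ∀ p q : MvPolynomial ι K, aeval η p = aeval η q →
      grad p η ⬝ᵥ w = grad q η ⬝ᵥ w := fun p q hpq => by
    have := hw (p - q) (mem_relIdeal.2 (by rw [map_sub, hpq, sub_self]))
    rw [← sub_eq_zero, ← this, ← sub_dotProduct]
    congr 1
    funext i
    simp [grad]
  -- On `K[η]` put `d (p(η)) = ∇p(η) · w`. The choice of `p` does not matter because `w` annihilates
  -- the gradients of all relations.
  let d : Derivation K A L := Derivation.mk'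
    { toFun := fun a => grad (g a) η ⬝ᵥ w
      map_add' := fun a b => by
        rw [hgrad (g (a + b)) (g a + g b) (by rw [map_add, hg, hg, hg]; rfl), ← add_dotProduct]
        congr 1
        funext i
        simp [grad]
      map_smul' := fun c a => by
        rw [hgrad (g (c • a)) (c • g a) (by rw [map_smul, hg, hg]; rfl), RingHom.id_apply,
          ← smul_dotProduct]
        congr 1
        funext i
        simp [grad] }
    (fun a b => by
      change grad (g (a * b)) η ⬝ᵥ w = a • (grad (g b) η ⬝ᵥ w) + b • (grad (g a) η ⬝ᵥ w)
      rw [hgrad (g (a * b)) (g a * g b) (by rw [map_mul, hg, hg, hg]; rfl), grad_mul_dotProduct,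
        hg, hg]
      rfl)
  have := formallySmooth_adjoin (K := K) (Set.range η)
  obtain ⟨D, hD⟩ := exists_derivation_extension d
  refine ⟨D, fun i => ?_⟩
  have h1 := hD ⟨η i, Algebra.subset_adjoin ⟨i, rfl⟩⟩
  change D (η i) = grad (g _) η ⬝ᵥ w at h1
  rw [h1, hgrad _ (X i) (by rw [hg, aeval_X])]
  simp [grad, dotProduct, pderiv_X, Pi.single_apply]

theorem toNat_trdeg_quotient_relIdeal {κ : Type*} (η : κ → L) :
    Cardinal.toNat (Algebra.trdeg K (MvPolynomial κ K ⧸ relIdeal K η)) =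
      Cardinal.toNat (Algebra.trdeg K (Algebra.adjoin K (Set.range η))) := by
  rw [Algebra.adjoin_range_eq_range_aeval, ← Cardinal.toNat_lift, relIdeal,
    AlgEquiv.lift_trdeg_eq (Ideal.quotientKerEquivRange (aeval η : MvPolynomial κ K →ₐ[K] L)),
    Cardinal.toNat_lift]

/-- The Jacobian criterion at a generic point. -/
theorem finrank_tangent_relIdeal [CharZero K] [Algebra.EssFiniteType K L] (η : ι → L) :
    (finrank L (tangent (relIdeal K η) η) : Cardinal) =
      Algebra.trdeg K (Algebra.adjoin K (Set.range η)) := by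
  classical
  let A := Algebra.adjoin K (Set.range η)
  let η' : ι → A := fun i => ⟨η i, Algebra.subset_adjoin ⟨i, rfl⟩⟩
  have hη' : Algebra.adjoin K (Set.range η') = ⊤ := by
    have := Algebra.adjoin_adjoin_coe_preimage (R := K) (s := Set.range η)
    convert this using 2
    ext a
    constructor
    · rintro ⟨i, rfl⟩; exact ⟨i, rfl⟩
    · rintro ⟨i, hi⟩; exact ⟨i, Subtype.ext hi⟩
  have halg : Algebra.IsAlgebraic (Algebra.adjoin K (Set.range η')) A := by
    rw [hη']
    exact ⟨fun a => isAlgebraic_algebraMap (⟨a, Algebra.mem_top⟩ : (⊤ : Subalgebra K A))⟩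
  obtain ⟨t, hts, ht⟩ := exists_isTranscendenceBasis_subset (R := K) (Set.range η')
  have hfin : t.Finite := (Set.finite_range η').subset hts
  have := hfin.fintype
  choose e he using fun a : t => hts a.2
  have heL : ∀ a : t, η (e a) = (a : A) := fun a => congrArg Subtype.val (he a)
  rw [← ht.cardinalMk_eq_trdeg, Cardinal.mk_fintype]
  norm_cast
  -- Restrict tangent vectors to a transcendence basis chosen among the coordinates. A derivation
  -- vanishing on the basis vanishes on everything algebraic over it, whence injectivity;
  -- independent coordinates have no relations, so any prescribed values come from a derivation,
  -- whence surjectivity.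
  let Φ : tangent (relIdeal K η) η →ₗ[L] (t → L) :=
    (LinearMap.funLeft L L e).comp (Submodule.subtype _)
  have hΦ : Function.Bijective Φ := by
    constructor
    · rw [← LinearMap.ker_eq_bot, eq_bot_iff]
      intro w hw
      obtain ⟨D, hD⟩ := exists_derivation_of_mem_tangent w.2
      refine (Submodule.mem_bot L).2 (Subtype.ext (funext fun i => ?_))
      rw [← hD i]
      have hw0 : ∀ a : t, D (a : A) = 0 := fun a => by
        rw [← heL, hD]
        exact congrFun (LinearMap.mem_ker.1 hw) a
      refine derivation_eq_zero_of_isAlgebraic D (s := A.val '' t) ?_ ?_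
      · rintro _ ⟨a, ha, rfl⟩
        exact hw0 ⟨a, ha⟩
      · have h1 := ht.isAlgebraic.isAlgebraic (η' i)
        rw [Subtype.range_coe] at h1
        have hle : ∀ y : Algebra.adjoin K t,
            A.val.comp (Algebra.adjoin K t).val y ∈ Algebra.adjoin K (A.val '' t) := fun y => by
          rw [← AlgHom.map_adjoin]
          exact ⟨y, y.2, rfl⟩
        exact h1.ringHom_of_comp_eq
          ((A.val.comp (Algebra.adjoin K t).val).codRestrict _ hle) A.val
          (fun a b hab => Subtype.ext (Subtype.ext (congrArg
            (fun y : Algebra.adjoin K (A.val '' t) => (y : L)) hab))) rfl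
    · intro u
      have hind : AlgebraicIndependent K (fun a : t => η (e a)) := by
        have := ht.1.map' (f := A.val) Subtype.val_injective
        convert this using 1
        exact funext heL
      have hu : u ∈ tangent (relIdeal K fun a : t => η (e a)) (fun a : t => η (e a)) := by
        refine mem_tangent.2 fun f hf => ?_
        have : f = 0 := (algebraicIndependent_iff.1 hind) f (mem_relIdeal.1 hf)
        simp [this, grad, dotProduct]
      obtain ⟨D, hD⟩ := exists_derivation_of_mem_tangent hu
      exact ⟨⟨_, derivation_mem_tangent D η⟩, funext hD⟩
  rw [(LinearEquiv.ofBijective Φ hΦ).finrank_eq, finrank_fintype_fun_eq_card]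

end Derivations

/-! ### Generic covectors and the differential calculus on the conormal variety -/

noncomputable section Conormal

variable {K : Type*} [Field K] {L : Type*} [Field L] [Algebra K L] {ι : Type*}

/-- The function on the conormal bundle obtained by substituting `∑ cⱼ ∇gⱼ` for the covector. -/
theorem aeval_substitute_covector {E : Type*} [CommRing E] [Algebra K E] {M : Type*} [Field M]
    [Algebra K M] [Algebra E M] [IsScalarTower K E M] {m : ℕ}
    (g : Fin m → MvPolynomial ι K) (h : MvPolynomial (ι ⊕ ι) K) (x : ι → E) (c : Fin m → M) :
    aeval c (aeval (Sum.elim (fun i => C (x i)) fun i => ∑ j, X j * C (aeval x (pderiv i (g j))))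
      h : MvPolynomial (Fin m) E) =
    aeval (Sum.elim (algebraMap E M ∘ x) (∑ j, c j • grad (g j) (algebraMap E M ∘ x))) h := by
  have h1 := comp_aeval_apply
    (f := Sum.elim (fun i => C (x i)) fun i => ∑ j, X j * C (aeval x (pderiv i (g j))))
    ((aeval c : MvPolynomial (Fin m) E →ₐ[E] M).restrictScalars K) h
  rw [AlgHom.restrictScalars_apply] at h1
  rw [h1]
  congr 2
  funext i
  rcases i with i | i
  · simp
  · simp only [Sum.elim_inr, AlgHom.restrictScalars_apply, map_sum, map_mul, aeval_X, aeval_C,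
      Finset.sum_apply, Pi.smul_apply, smul_eq_mul, grad]
    refine Finset.sum_congr rfl fun j _ => ?_
    congr 1
    exact comp_aeval_apply (R := K) (f := x) (IsScalarTower.toAlgHom K E M) (pderiv i (g j))

/-- Substituting covectors with coefficients in the base field. -/
theorem aeval_substitute_const_covector {m : ℕ} (g : Fin m → MvPolynomial ι K)
    (h : MvPolynomial (ι ⊕ ι) K) (x : ι → L) (c : Fin m → K) :
    aeval x (aeval (Sum.elim X fun i => ∑ j, C (c j) * pderiv i (g j)) h : MvPolynomial ι K) =
    aeval (Sum.elim x (∑ j, algebraMap K L (c j) • grad (g j) x)) h := by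
  rw [comp_aeval_apply]
  congr 2
  funext i
  rcases i with i | i
  · simp
  · simp [grad, Algebra.smul_def]

/-- A relation of `(x, ξ)` is a polynomial in the independent `t`, hence it holds at `(x, η)` for
every conormal `η` at `x`. Writing `ξ₀ = ∑ cⱼ ∇fⱼ(x₀)` with constant `cⱼ` and taking `η = ∑ cⱼ
∇fⱼ(x)` gives a relation of `x` alone, which specializes to `x₀`. -/
theorem relIdeal_sumElim_le_of_algebraicIndependent {m : ℕ} {x ξ : ι → L} {t : Fin m → L}
    (ht : AlgebraicIndependent (Algebra.adjoin K (Set.range x)) t) {g : Fin m → MvPolynomial ι K}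
    (hg : conormal (relIdeal K x) x ≤ Submodule.span L (Set.range fun j => grad (g j) x))
    (hξ : ξ = ∑ j, t j • grad (g j) x) {x₀ ξ₀ : ι → K} (hx₀ : relIdeal K x ≤ relIdeal K x₀)
    (hξ₀ : ξ₀ ∈ conormal (relIdeal K x) x₀) :
    relIdeal K (Sum.elim x ξ) ≤ relIdeal K (Sum.elim x₀ ξ₀) := by
  intro h hh
  let x' : ι → Algebra.adjoin K (Set.range x) := fun i => ⟨x i, Algebra.subset_adjoin ⟨i, rfl⟩⟩
  have hx' : algebraMap _ L ∘ x' = x := rfl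
  obtain ⟨k, c, f, hf, rfl⟩ := exists_sum_of_mem_conormal hξ₀
  set H : MvPolynomial (Fin m) (Algebra.adjoin K (Set.range x)) :=
    aeval (Sum.elim (fun i => C (x' i)) fun i => ∑ j, X j * C (aeval x' (pderiv i (g j)))) h
  have hH : ∀ c : Fin m → L,
      aeval c H = aeval (Sum.elim x (∑ j, c j • grad (g j) x)) h := fun c => by
    rw [aeval_substitute_covector, hx']
  have hH0 : H = 0 := by
    refine algebraicIndependent_iff.1 ht H ?_
    rw [hH, ← hξ]
    exact hh
  have hmem : (∑ j, algebraMap K L (c j) • grad (f j) x) ∈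
      Submodule.span L (Set.range fun j => grad (g j) x) :=
    hg (sum_mem fun j _ => Submodule.smul_mem _ _ (grad_mem_conormal (hf j) x))
  obtain ⟨τ, hτ⟩ := (Submodule.mem_span_range_iff_exists_fun L).1 hmem
  have h2 := hx₀ (show aeval (Sum.elim X fun i => ∑ j, C (c j) * pderiv i (f j)) h ∈
      relIdeal K x by
    rw [mem_relIdeal, aeval_substitute_const_covector, ← hτ, ← hH, hH0, map_zero])
  rw [mem_relIdeal, aeval_substitute_const_covector] at h2
  exact h2

theorem exists_conormal_aeval_ne_zero [Infinite K] {x ξ : ι → L}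
    (hξ : ξ ∈ conormal (relIdeal K x) x) {Z : Set (ι → K)}
    (hZ : ∀ p : MvPolynomial ι K, aeval x p ≠ 0 → ∃ x₀ ∈ Z, aeval x₀ p ≠ 0)
    {h : MvPolynomial (ι ⊕ ι) K} (hh : aeval (Sum.elim x ξ) h ≠ 0) :
    ∃ x₀ ∈ Z, ∃ ξ₀ ∈ conormal (relIdeal K x) x₀, aeval (Sum.elim x₀ ξ₀) h ≠ 0 := by
  obtain ⟨m, c, g, hg, rfl⟩ := exists_sum_of_mem_conormal hξ
  set H : MvPolynomial (Fin m) L :=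
    aeval (Sum.elim (fun i => C (x i)) fun i => ∑ j, X j * C (aeval x (pderiv i (g j)))) h
  have hH : ∀ c : Fin m → L,
      aeval c H = aeval (Sum.elim x (∑ j, c j • grad (g j) x)) h := fun c => by
    rw [aeval_substitute_covector]
    rfl
  have hH0 : H ≠ 0 := fun h0 => hh (by rw [← hH, h0, map_zero])
  -- As `K` is infinite, the coefficients in `L` can be replaced by constants; what remains is a
  -- polynomial condition on `x` alone.
  obtain ⟨c₀, hc₀⟩ : ∃ c₀ : Fin m → K, aeval (algebraMap K L ∘ c₀) H ≠ 0 := by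
    by_contra! hcon
    refine hH0 (MvPolynomial.funext_set (fun _ => Set.range (algebraMap K L))
      (fun _ => Set.infinite_range_of_injective (algebraMap K L).injective) fun y hy => ?_)
    choose c₀ hc₀ using fun j => hy j (Set.mem_univ j)
    rw [map_zero, ← hcon c₀, ← funext hc₀]
    rfl
  rw [hH] at hc₀
  obtain ⟨x₀, hx₀, hne⟩ := hZ (aeval (Sum.elim X fun i => ∑ j, C (c₀ j) * pderiv i (g j)) h)
    (by rw [aeval_substitute_const_covector]; exact hc₀)
  rw [aeval_substitute_const_covector] at hne
  exact ⟨x₀, hx₀, _, sum_mem fun j _ => Submodule.smul_mem _ _ (grad_mem_conormal (hg j) x₀), hne⟩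

theorem relIdeal_sumElim_swap {L' : Type*} [Field L'] [Algebra K L'] {x ξ : ι → L}
    {x₀ ξ₀ : ι → L'}
    (h : relIdeal K (Sum.elim x ξ) ≤ relIdeal K (Sum.elim x₀ ξ₀)) :
    relIdeal K (Sum.elim ξ x) ≤ relIdeal K (Sum.elim ξ₀ x₀) := by
  intro p hp
  have h1 := h (show rename Sum.swap p ∈ relIdeal K (Sum.elim x ξ) by
    rw [mem_relIdeal, aeval_rename, Sum.elim_swap]
    exact hp)
  rw [mem_relIdeal, aeval_rename, Sum.elim_swap] at h1
  exact h1

theorem relIdeal_le_of_sumElim_le {L' : Type*} [Field L'] [Algebra K L'] {x ξ : ι → L}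
    {x₀ ξ₀ : ι → L'}
    (h : relIdeal K (Sum.elim x ξ) ≤ relIdeal K (Sum.elim x₀ ξ₀)) :
    relIdeal K x ≤ relIdeal K x₀ := by
  intro p hp
  have h1 := h (show rename Sum.inl p ∈ relIdeal K (Sum.elim x ξ) by
    rw [mem_relIdeal, aeval_rename, Sum.elim_comp_inl]
    exact hp)
  rw [mem_relIdeal, aeval_rename, Sum.elim_comp_inl] at h1
  exact h1

/-- `(x, ξ)` is a generic point of the conormal variety both of the variety with generic point `x`
and of the variety with generic point `ξ`. -/
structure IsConormalPair (K : Type*) [Field K] [Algebra K L] (x ξ : ι → L) : Prop where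
  mem_left : ξ ∈ conormal (relIdeal K x) x
  mem_right : x ∈ conormal (relIdeal K ξ) ξ
  spec_left : ∀ x₀ ξ₀ : ι → K, relIdeal K x ≤ relIdeal K x₀ → ξ₀ ∈ conormal (relIdeal K x) x₀ →
    relIdeal K (Sum.elim x ξ) ≤ relIdeal K (Sum.elim x₀ ξ₀)
  spec_right : ∀ x₀ ξ₀ : ι → K, relIdeal K ξ ≤ relIdeal K ξ₀ → x₀ ∈ conormal (relIdeal K ξ) ξ₀ →
    relIdeal K (Sum.elim x ξ) ≤ relIdeal K (Sum.elim x₀ ξ₀)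

theorem IsConormalPair.symm {x ξ : ι → L} (h : IsConormalPair K x ξ) : IsConormalPair K ξ x :=
  ⟨h.mem_right, h.mem_left,
    fun _ _ hx hξ => relIdeal_sumElim_swap (h.spec_right _ _ hx hξ),
    fun _ _ hx hξ => relIdeal_sumElim_swap (h.spec_left _ _ hx hξ)⟩

/-- Coefficients with respect to independent vectors lie in the field generated by the entries. -/
theorem coeff_mem_of_linearIndependent (M : IntermediateField K L) {κ : Type*} {m : ℕ}
    {a : Fin m → κ → L} (ha : LinearIndependent L a) (haM : ∀ j k, a j k ∈ M) {t : Fin m → L}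
    (hb : ∀ k, (∑ j, t j • a j) k ∈ M) (j : Fin m) : t j ∈ M := by
  obtain ⟨c, hc⟩ := (linearIndependent_iff_exists_minor a).1 ha
  let A : Matrix (Fin m) (Fin m) M := Matrix.of fun i j => ⟨a i (c j), haM i (c j)⟩
  let b : Fin m → M := fun j => ⟨(∑ i, t i • a i) (c j), hb (c j)⟩
  have hA : A.map (algebraMap M L) = Matrix.of fun i j => a i (c j) := rfl
  have hdet : IsUnit A.det := isUnit_iff_ne_zero.2 fun h0 => hc (by
    rw [← hA, ← RingHom.mapMatrix_apply, ← RingHom.map_det, h0, map_zero])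
  have h1 : Matrix.vecMul t (A.map (algebraMap M L)) = algebraMap M L ∘ b := by
    funext j
    simp only [hA, Matrix.vecMul, dotProduct, Matrix.of_apply, Function.comp_apply]
    exact (Finset.sum_apply (c j) Finset.univ fun i => t i • a i).symm
  have h2 : Matrix.vecMul (algebraMap M L ∘ Matrix.vecMul b A⁻¹) (A.map (algebraMap M L)) =
      algebraMap M L ∘ b := by
    funext j
    rw [← RingHom.map_vecMul, Matrix.vecMul_vecMul, Matrix.nonsing_inv_mul A hdet,
      Matrix.vecMul_one]
    rfl
  have h3 : t = algebraMap M L ∘ Matrix.vecMul b A⁻¹ := by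
    rw [← sub_eq_zero]
    refine Matrix.eq_zero_of_vecMul_eq_zero (M := A.map (algebraMap M L)) hc ?_
    rw [Matrix.sub_vecMul, h1, h2, sub_self]
  rw [h3]
  exact SetLike.coe_mem _

variable [Fintype ι] [CharZero K]

section EssFinite

variable [Algebra.EssFiniteType K L]

/-- Differentiating `ξ = ∑ cⱼ ∇gⱼ(x)` gives `Dξ = ∑ (D cⱼ ∇gⱼ(x) + cⱼ Hess gⱼ(Dx))`. A vector of the
Gauss kernel is orthogonal to the gradients by tangency and to the Hessian terms by definition of
the kernel. -/
theorem gaussKer_le_conormal {x ξ : ι → L} (hξ : ξ ∈ conormal (relIdeal K x) x) :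
    gaussKer (relIdeal K x) x ≤ conormal (relIdeal K ξ) ξ := by
  intro v hv
  rw [← dotAnn_tangent]
  intro w hw
  obtain ⟨D, hD⟩ := exists_derivation_of_mem_tangent hw
  obtain ⟨m, c, g, hg, rfl⟩ := exists_sum_of_mem_conormal hξ
  have hw' : w = ∑ j, (D (c j) • grad (g j) x + c j • hess (g j) x fun i => D (x i)) := by
    funext i
    rw [← hD i]
    simp only [Finset.sum_apply, map_sum, Pi.smul_apply, smul_eq_mul, Derivation.leibniz,
      Pi.add_apply, ← derivation_grad]
    exact Finset.sum_congr rfl fun j _ => by ring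
  rw [hw', dotProduct_sum]
  refine Finset.sum_eq_zero fun j _ => ?_
  have h1 := mem_tangent.1 hv.1 _ (hg j)
  have h2 := congrFun (hv.2 _ (derivation_mem_tangent D x)) ⟨g j, hg j⟩
  rw [hessBilin_apply, hess_dotProduct_comm] at h2
  rw [dotProduct_add, dotProduct_smul, dotProduct_smul, dotProduct_comm v, dotProduct_comm v, h1]
  simp only [smul_zero, zero_add]
  rw [h2]
  simp

/-- For `g` in the ideal of `ξ`, the hypothesis gives `∇f(x) · ∇g(ξ) = 0` and `Hess f(Dx) · ∇g(ξ) =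
0`. Differentiating the first, `Hess g(Dξ) = D(∇g(ξ))` is tangent at `x`, hence orthogonal to every
conormal vector there. -/
theorem conormal_le_gaussKer {x ξ : ι → L}
    (h : conormal (relIdeal K ξ) ξ ≤ gaussKer (relIdeal K x) x) :
    conormal (relIdeal K x) x ≤ gaussKer (relIdeal K ξ) ξ := by
  intro u hu
  have hu' : ∀ v ∈ tangent (relIdeal K x) x, u ⬝ᵥ v = 0 := by
    rw [← dotAnn_tangent] at hu
    exact hu
  refine ⟨mem_tangent.2 fun g hg => ?_, fun w hw => funext fun g => ?_⟩
  · rw [dotProduct_comm]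
    exact hu' _ (h (grad_mem_conormal hg ξ)).1
  · obtain ⟨D, hD⟩ := exists_derivation_of_mem_tangent hw
    have hv := h (grad_mem_conormal g.2 ξ)
    have hDv : (fun i => D (grad (g : MvPolynomial ι K) ξ i)) ∈ tangent (relIdeal K x) x := by
      refine mem_tangent.2 fun f hf => ?_
      have h1 := derivation_dotProduct D (grad f x) (grad (g : MvPolynomial ι K) ξ)
      have h2 := congrFun (hv.2 _ (derivation_mem_tangent D x)) ⟨f, hf⟩
      rw [hessBilin_apply, hess_dotProduct_comm] at h2
      rw [mem_tangent.1 hv.1 f hf, map_zero, derivation_grad D x f] at h1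
      change _ = (0 : L) at h2
      rw [h2, add_zero] at h1
      exact h1.symm
    have h3 := hu' _ hDv
    rw [derivation_grad, dotProduct_comm] at h3
    rw [hessBilin_apply, hess_dotProduct_comm, ← funext hD]
    exact h3

/-- In `0 = D(x · ξ) = x · Dξ + Dx · ξ` the last term vanishes because `ξ` is conormal at `x`. -/
theorem mem_conormal_comm {x ξ : ι → L} (hξ : ξ ∈ conormal (relIdeal K x) x) (h0 : x ⬝ᵥ ξ = 0) :
    x ∈ conormal (relIdeal K ξ) ξ := by
  rw [← dotAnn_tangent]
  intro w hw
  obtain ⟨D, hD⟩ := exists_derivation_of_mem_tangent hw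
  have h1 := derivation_dotProduct D x ξ
  have h2 : ξ ⬝ᵥ (fun i => D (x i)) = 0 := by
    rw [← dotAnn_tangent] at hξ
    exact hξ _ (derivation_mem_tangent D x)
  rw [h0, map_zero, dotProduct_comm _ ξ, h2, add_zero, funext hD] at h1
  exact h1.symm

end EssFinite

end Conormal

/-! ### Existence of generic conormal pairs and reflexivity -/

noncomputable section GenericPair

variable {K : Type*} [Field K] {L : Type*} [Field L] [Algebra K L] {ι : Type*}

theorem isAlgebraic_adjoin_adjoin {s t : Set L} (h : IntermediateField.adjoin K (s ∪ t) = ⊤) :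
    Algebra.IsAlgebraic (Algebra.adjoin (Algebra.adjoin K s) t) L := by
  have h1 : Algebra.IsAlgebraic (IntermediateField.adjoin K (s ∪ t)) L := by
    rw [h]
    exact ⟨fun y => isAlgebraic_algebraMap (⟨y, trivial⟩ : (⊤ : IntermediateField K L))⟩
  rw [IntermediateField.isAlgebraic_adjoin_iff_top] at h1
  have h2 := Algebra.adjoin_union_eq_adjoin_adjoin K s t
  rw [h2] at h1
  exact h1

theorem essFiniteType_of_adjoin_eq_top {s : Set L} (hs : s.Finite)
    (h : IntermediateField.adjoin K s = ⊤) : Algebra.EssFiniteType K L := by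
  refine IntermediateField.fg_top_iff.1 ?_
  exact ⟨hs.toFinset, by rw [Set.Finite.coe_toFinset]; exact h⟩

theorem aeval_mem_intermediateField {κ : Type*} (M : IntermediateField K L) {η : κ → L}
    (h : ∀ i, η i ∈ M) (p : MvPolynomial κ K) : aeval η p ∈ M := by
  have : aeval η p = algebraMap M L (aeval (fun i => (⟨η i, h i⟩ : M)) p) :=
    (comp_aeval_apply (R := K) (f := fun i => (⟨η i, h i⟩ : M)) (IsScalarTower.toAlgHom K M L)
      p).symm
  rw [this]
  exact SetLike.coe_mem _

variable [Fintype ι] [CharZero K]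

theorem trdeg_add_eq_of_adjoin [Algebra.EssFiniteType K L] (x : ι → L) :
    (finrank L (tangent (relIdeal K x) x) : Cardinal) +
      Algebra.trdeg (Algebra.adjoin K (Set.range x)) L = Algebra.trdeg K L := by
  rw [finrank_tangent_relIdeal]
  exact trdeg_add_eq K (Algebra.adjoin K (Set.range x)) (A := L)

theorem trdeg_eq_of_generic_extension [Algebra.EssFiniteType K L] {x : ι → L} {m : ℕ}
    {t : Fin m → L} (ht : AlgebraicIndependent (Algebra.adjoin K (Set.range x)) t)
    (htop : IntermediateField.adjoin K (Set.range x ∪ Set.range t) = ⊤) :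
    Algebra.trdeg K L = (finrank L (tangent (relIdeal K x) x) + m : ℕ) := by
  have := isAlgebraic_adjoin_adjoin htop
  have hb := ht.isTranscendenceBasis_iff_isAlgebraic.2 this
  have h1 := hb.lift_cardinalMk_eq_trdeg
  rw [← trdeg_add_eq_of_adjoin x, Nat.cast_add]
  congr 1
  simpa using h1.symm

theorem algebraicIndependent_of_trdeg_le [Algebra.EssFiniteType K L] {x : ι → L} {m : ℕ}
    {t : Fin m → L}
    (htop : IntermediateField.adjoin K (Set.range x ∪ Set.range t) = ⊤)
    (h : Algebra.trdeg K L = (finrank L (tangent (relIdeal K x) x) + m : ℕ)) :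
    AlgebraicIndependent (Algebra.adjoin K (Set.range x)) t := by
  have := isAlgebraic_adjoin_adjoin htop
  rw [← trdeg_add_eq_of_adjoin x, Nat.cast_add] at h
  have h1 := Cardinal.eq_of_add_eq_add_left h Cardinal.natCast_lt_aleph0
  refine (Algebra.IsAlgebraic.isTranscendenceBasis_of_lift_le_trdeg_of_finite _ t ?_).1
  rw [h1]
  simp

/-- A generic covector over a generic point of a cone yields a generic point of the conormal
variety, which is symmetric in the point and the covector. -/
theorem isConormalPair_of_algebraicIndependent [Algebra.EssFiniteType K L] {x : ι → L}
    {t : Fin (finrank L (conormal (relIdeal K x) x)) → L}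
    (ht : AlgebraicIndependent (Algebra.adjoin K (Set.range x)) t)
    (htop : IntermediateField.adjoin K (Set.range x ∪ Set.range t) = ⊤)
    (heuler : ∀ f ∈ relIdeal K x, grad f x ⬝ᵥ x = 0) :
    ∃ ξ : ι → L, IsConormalPair K x ξ := by
  obtain ⟨g, hg, hgspan⟩ := exists_basis_conormal (relIdeal K x) x
  set ξ := ∑ j, t j • grad (g j : MvPolynomial ι K) x with hξ
  have hmem : ξ ∈ conormal (relIdeal K x) x :=
    sum_mem fun j _ => Submodule.smul_mem _ _ (grad_mem_conormal (g j).2 x)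
  have hmem' : x ∈ conormal (relIdeal K ξ) ξ := by
    refine mem_conormal_comm hmem ?_
    rw [hξ, dotProduct_sum]
    refine Finset.sum_eq_zero fun j _ => ?_
    rw [dotProduct_smul, dotProduct_comm, heuler _ (g j).2, smul_zero]
  obtain ⟨f, hf, hfspan⟩ := exists_basis_conormal (relIdeal K ξ) ξ
  rw [← hfspan] at hmem'
  obtain ⟨s, hs⟩ := (Submodule.mem_span_range_iff_exists_fun L).1 hmem'
  -- From `ξ` and `s` one recovers `x` as a combination of gradients at `ξ`, and then `t` as the
  -- coefficients of `ξ` in a basis defined over `K(x)`.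
  have hadj : IntermediateField.adjoin K (Set.range ξ ∪ Set.range s) = ⊤ := by
    set M := IntermediateField.adjoin K (Set.range ξ ∪ Set.range s)
    have hξM : ∀ i, ξ i ∈ M := fun i => IntermediateField.subset_adjoin K _ (Or.inl ⟨i, rfl⟩)
    have hsM : ∀ i, s i ∈ M := fun i => IntermediateField.subset_adjoin K _ (Or.inr ⟨i, rfl⟩)
    have hxM : ∀ i, x i ∈ M := fun i => by
      rw [← hs, Finset.sum_apply]
      exact sum_mem fun j _ => mul_mem (hsM j) (aeval_mem_intermediateField M hξM _)
    have htM : ∀ j, t j ∈ M := coeff_mem_of_linearIndependent M hg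
      (fun j k => aeval_mem_intermediateField M hxM _) hξM
    rw [eq_top_iff, ← htop, IntermediateField.adjoin_le_iff]
    rintro _ (⟨i, rfl⟩ | ⟨i, rfl⟩)
    · exact hxM i
    · exact htM i
  have hsind : AlgebraicIndependent (Algebra.adjoin K (Set.range ξ)) s := by
    refine algebraicIndependent_of_trdeg_le hadj ?_
    -- Tangent plus conormal dimension is the number of coordinates at `x` and at `ξ` alike, so `s`
    -- has exactly as many members as independence requires.
    rw [trdeg_eq_of_generic_extension ht htop, finrank_tangent_add, finrank_tangent_add]
  refine ⟨ξ, hmem, hfspan ▸ hmem', fun x₀ ξ₀ h1 h2 => ?_, fun x₀ ξ₀ h1 h2 => ?_⟩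
  · exact relIdeal_sumElim_le_of_algebraicIndependent ht hgspan.ge hξ h1 h2
  · exact relIdeal_sumElim_swap
      (relIdeal_sumElim_le_of_algebraicIndependent hsind hfspan.ge hs.symm h1 h2)

universe u

theorem exists_generic_extension {K : Type u} [Field K] {ι : Type} [Fintype ι]
    (I : Ideal (MvPolynomial ι K)) [I.IsPrime] :
    ∃ (L : Type u) (_ : Field L) (_ : Algebra K L) (x : ι → L)
      (t : Fin (finrank L (conormal I x)) → L), relIdeal K x = I ∧
      AlgebraicIndependent (Algebra.adjoin K (Set.range x)) t ∧
      IntermediateField.adjoin K (Set.range x ∪ Set.range t) = ⊤ := by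
  let A := MvPolynomial ι K ⧸ I
  let xA : ι → A := fun i => Ideal.Quotient.mk I (X i)
  have hxA : ∀ p : MvPolynomial ι K, aeval xA p = Ideal.Quotient.mk I p := fun p => by
    have : (aeval xA : MvPolynomial ι K →ₐ[K] A) = Ideal.Quotient.mkₐ K I :=
      MvPolynomial.algHom_ext fun i => by rw [aeval_X]; rfl
    rw [this]
    rfl
  have hrel : ∀ (F : Type u) [Field F] [Algebra K F] [Algebra A F] [IsScalarTower K A F],
      Function.Injective (algebraMap A F) → relIdeal K (fun i => algebraMap A F (xA i)) = I := by
    intro F _ _ _ _ hinj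
    ext p
    have h1 : aeval (fun i => algebraMap A F (xA i)) p = algebraMap A F (Ideal.Quotient.mk I p) := by
      rw [← hxA]
      exact (comp_aeval_apply (R := K) (f := xA) (IsScalarTower.toAlgHom K A F) p).symm
    rw [mem_relIdeal, h1, map_eq_zero_iff _ hinj, Ideal.Quotient.eq_zero_iff_mem]
  let F := FractionRing A
  let xF : ι → F := fun i => algebraMap A F (xA i)
  have hF : relIdeal K xF = I := hrel F (IsFractionRing.injective A F)
  -- The number of new variables has to be known before `L` is built. It is computed over the
  -- function field and agrees with the rank over `L`, as ranks depend only on the relation ideal.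
  let m := finrank F (conormal I xF)
  let B := MvPolynomial (Fin m) A
  let L := FractionRing B
  have hBL : Function.Injective (algebraMap B L) := IsFractionRing.injective B L
  have hAL : Function.Injective (algebraMap A L) := by
    rw [IsScalarTower.algebraMap_eq A B L]
    exact hBL.comp (MvPolynomial.C_injective _ _)
  let x : ι → L := fun i => algebraMap A L (xA i)
  have hx : relIdeal K x = I := hrel L hAL
  have hm : m = finrank L (conormal I x) :=
    le_antisymm (finrank_conormal_le (hx.trans hF.symm).le)
      (finrank_conormal_le (hF.trans hx.symm).le)
  let t : Fin m → L := fun j => algebraMap B L (X j)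
  have ht : AlgebraicIndependent A t :=
    (MvPolynomial.algebraicIndependent_X (Fin m) A).map'
      (f := IsScalarTower.toAlgHom A B L) hBL
  have hAmem : ∀ a : A, algebraMap A L a ∈ Algebra.adjoin K (Set.range x) := by
    intro a
    obtain ⟨p, rfl⟩ := Ideal.Quotient.mk_surjective a
    rw [← hxA, Algebra.adjoin_range_eq_range_aeval]
    exact ⟨p, (comp_aeval_apply (R := K) (f := xA) (IsScalarTower.toAlgHom K A L) p).symm⟩
  have ht' : AlgebraicIndependent (Algebra.adjoin K (Set.range x)) t := by
    let φ : A →ₐ[K] Algebra.adjoin K (Set.range x) :=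
      (IsScalarTower.toAlgHom K A L).codRestrict _ hAmem
    refine ht.ringHom_of_comp_eq φ (RingHom.id L) ?_ Function.injective_id ?_
    · rintro ⟨y, hy⟩
      rw [Algebra.adjoin_range_eq_range_aeval] at hy
      obtain ⟨p, rfl⟩ := hy
      refine ⟨aeval xA p, Subtype.ext ?_⟩
      exact comp_aeval_apply (R := K) (f := xA) (IsScalarTower.toAlgHom K A L) p
    · rfl
  have htop : IntermediateField.adjoin K (Set.range x ∪ Set.range t) = ⊤ := by
    rw [eq_top_iff]
    rintro y -
    set M := IntermediateField.adjoin K (Set.range x ∪ Set.range t)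
    have hB : ∀ b : B, algebraMap B L b ∈ M := by
      intro b
      induction b using MvPolynomial.induction_on with
      | C a =>
        have h1 : algebraMap B L (C a) = algebraMap A L a :=
          (IsScalarTower.algebraMap_apply A B L a).symm
        rw [h1]
        exact (Algebra.adjoin_le fun z hz => IntermediateField.subset_adjoin K _ (Or.inl hz) :
          Algebra.adjoin K (Set.range x) ≤ M.toSubalgebra) (hAmem a)
      | add p q hp hq => rw [map_add]; exact add_mem hp hq
      | mul_X p j hp =>
        rw [map_mul]
        exact mul_mem hp (IntermediateField.subset_adjoin K _ (Or.inr ⟨j, rfl⟩))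
    obtain ⟨a, b, -, rfl⟩ := IsFractionRing.div_surjective (A := B) y
    exact div_mem (hB a) (hB b)
  refine ⟨L, inferInstance, inferInstance, x, t ∘ Fin.cast hm.symm, hx, ?_, ?_⟩
  · exact ht'.comp _ (Fin.cast_injective _)
  · have hrange : Set.range (t ∘ Fin.cast hm.symm) = Set.range t :=
      (finCongr hm.symm).surjective.range_comp t
    rw [hrange]
    exact htop

end GenericPair

/-! ### Zariski topology in terms of affine cones -/

noncomputable section Cones

variable {K : Type*} [Field K]

theorem aeval_smul_of_isHomogeneous {ι : Type*} {f : MvPolynomial ι K} {d : ℕ}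
    (hf : f.IsHomogeneous d) (c : K) (v : ι → K) : aeval (c • v) f = c ^ d * aeval v f := by
  simp only [aeval_def, eval₂_eq, Finset.mul_sum]
  refine Finset.sum_congr rfl fun m hm => ?_
  have hd : ∑ i ∈ m.support, m i = d := by
    have := hf (mem_support_iff.1 hm)
    simpa [Finsupp.weight_apply, Finsupp.sum] using this
  simp only [Pi.smul_apply, smul_eq_mul, mul_pow, Finset.prod_mul_distrib,
    Finset.prod_pow_eq_pow_sum, hd]
  ring

/-- The restriction of a polynomial to the line through `v`. -/
def linePoly {ι : Type*} (f : MvPolynomial ι K) (v : ι → K) : Polynomial K :=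
  ∑ d ∈ Finset.range (f.totalDegree + 1),
    Polynomial.monomial d (aeval v (homogeneousComponent d f))

theorem eval_linePoly {ι : Type*} (f : MvPolynomial ι K) (v : ι → K) (c : K) :
    (linePoly f v).eval c = aeval (c • v) f := by
  conv_rhs => rw [← sum_homogeneousComponent f]
  rw [linePoly, Polynomial.eval_finsetSum, map_sum]
  refine Finset.sum_congr rfl fun d _ => ?_
  rw [aeval_smul_of_isHomogeneous (homogeneousComponent_isHomogeneous d f),
    Polynomial.eval_monomial, mul_comm]

theorem coeff_linePoly {ι : Type*} (f : MvPolynomial ι K) (v : ι → K) (d : ℕ) :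
    (linePoly f v).coeff d = aeval v (homogeneousComponent d f) := by
  rw [linePoly, Polynomial.finsetSum_coeff]
  simp only [Polynomial.coeff_monomial]
  rw [Finset.sum_ite_eq' (Finset.range (f.totalDegree + 1)) d]
  split_ifs with h
  · rfl
  · rw [homogeneousComponent_eq_zero, map_zero]
    simpa using h

/-- On the line through `v` both are nonzero univariate polynomials; their product with the
coordinate has a non-root because `K` is infinite. -/
theorem exists_ne_zero_smul_aeval_ne_zero [Infinite K] {ι : Type*} {f g : MvPolynomial ι K}
    {v : ι → K} (hf : ∃ c : K, aeval (c • v) f ≠ 0) (hg : ∃ c : K, aeval (c • v) g ≠ 0) :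
    ∃ c : K, c ≠ 0 ∧ aeval (c • v) f ≠ 0 ∧ aeval (c • v) g ≠ 0 := by
  have hne : ∀ h : MvPolynomial ι K, (∃ c : K, aeval (c • v) h ≠ 0) → linePoly h v ≠ 0 := by
    rintro h ⟨c, hc⟩ h0
    rw [← eval_linePoly, h0, Polynomial.eval_zero] at hc
    exact hc rfl
  have h1 : Polynomial.X * (linePoly f v * linePoly g v) ≠ 0 :=
    mul_ne_zero Polynomial.X_ne_zero (mul_ne_zero (hne f hf) (hne g hg))
  obtain ⟨c, hc⟩ : ∃ c, (Polynomial.X * (linePoly f v * linePoly g v)).eval c ≠ 0 := by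
    by_contra! hcon
    exact h1 (Polynomial.funext fun c => by rw [hcon c, Polynomial.eval_zero])
  simp only [Polynomial.eval_mul, Polynomial.eval_X, eval_linePoly] at hc
  exact ⟨c, left_ne_zero_of_mul hc, left_ne_zero_of_mul (right_ne_zero_of_mul hc),
    right_ne_zero_of_mul (right_ne_zero_of_mul hc)⟩

variable {N : ℕ}

theorem smul_rep_mem (p : ProjSpace K N) (c : K) : c • p.rep ∈ p.submodule := by
  rw [Projectivization.submodule_eq]
  exact Submodule.smul_mem _ _ (Submodule.mem_span_singleton_self _)

theorem rep_mem (p : ProjSpace K N) : p.rep ∈ p.submodule := by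
  simpa using smul_rep_mem p 1

theorem exists_smul_rep {p : ProjSpace K N} {v : Fin (N + 1) → K} (hv : v ∈ p.submodule) :
    ∃ c : K, v = c • p.rep := by
  rw [Projectivization.submodule_eq] at hv
  obtain ⟨c, rfl⟩ := Submodule.mem_span_singleton.1 hv
  exact ⟨c, rfl⟩

theorem exists_ne_zero_smul_rep {p : ProjSpace K N} {v : Fin (N + 1) → K} (hv : v ∈ p.submodule)
    (h0 : v ≠ 0) : ∃ c : K, c ≠ 0 ∧ v = c • p.rep := by
  obtain ⟨c, rfl⟩ := exists_smul_rep hv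
  exact ⟨c, fun h => h0 (by rw [h, zero_smul]), rfl⟩

theorem exists_point_of_ne_zero {v : Fin (N + 1) → K} (hv : v ≠ 0) :
    ∃ p : ProjSpace K N, v ∈ p.submodule :=
  ⟨Projectivization.mk K v hv, by
    rw [Projectivization.submodule_mk]; exact Submodule.mem_span_singleton_self v⟩

theorem submodule_le_iff_rep_mem {p : ProjSpace K N} {W : Submodule K (Fin (N + 1) → K)} :
    p.submodule ≤ W ↔ p.rep ∈ W := by
  rw [Projectivization.submodule_eq, Submodule.span_singleton_le_iff_mem]

theorem mem_idealOf {S : Set (ProjSpace K N)} {f : MvPolynomial (Fin (N + 1)) K} :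
    f ∈ idealOf S ↔ ∀ p ∈ S, ∀ v ∈ p.submodule, aeval v f = 0 :=
  ⟨fun h p hp v hv => h v ⟨p, hp, hv⟩, fun h _ ⟨p, hp, hv⟩ => h p hp _ hv⟩

theorem homogeneousComponent_mem_idealOf [Infinite K] {S : Set (ProjSpace K N)}
    {f : MvPolynomial (Fin (N + 1)) K} (hf : f ∈ idealOf S) (d : ℕ) :
    homogeneousComponent d f ∈ idealOf S := by
  rw [mem_idealOf] at hf ⊢
  intro p hp v hv
  have h0 : linePoly f v = 0 := Polynomial.funext fun c => by
    rw [eval_linePoly, Polynomial.eval_zero]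
    exact hf p hp _ (p.submodule.smul_mem c hv)
  rw [← coeff_linePoly, h0, Polynomial.coeff_zero]

theorem idealOf_le_relIdeal {S : Set (ProjSpace K N)} {p : ProjSpace K N} (hp : p ∈ S)
    {v : Fin (N + 1) → K} (hv : v ∈ p.submodule) : idealOf S ≤ relIdeal K v :=
  fun _ hf => mem_relIdeal.2 (mem_idealOf.1 hf p hp v hv)

theorem isClosed_iff_exists {Z : Set (ProjSpace K N)} :
    IsClosed Z ↔ ∃ S : Set (MvPolynomial (Fin (N + 1)) K),
      (∀ f ∈ S, ∃ d, f.IsHomogeneous d) ∧ Z = {p | ∀ f ∈ S, MvPolynomial.eval p.rep f = 0} := by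
  rw [← isOpen_compl_iff]
  change Zᶜᶜ ∈ {Z : Set (ProjSpace K N) | ∃ S : Set (MvPolynomial (Fin (N + 1)) K),
      (∀ f ∈ S, ∃ d, f.IsHomogeneous d) ∧ Z = {p | ∀ f ∈ S, MvPolynomial.eval p.rep f = 0}} ↔ _
  rw [compl_compl]
  rfl

theorem mem_of_isClosed {Z : Set (ProjSpace K N)} (hZ : IsClosed Z) {p : ProjSpace K N}
    {v : Fin (N + 1) → K} (hv : v ∈ p.submodule) (h0 : v ≠ 0) (h : idealOf Z ≤ relIdeal K v) :
    p ∈ Z := by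
  obtain ⟨S, hS, rfl⟩ := isClosed_iff_exists.1 hZ
  intro f hf
  obtain ⟨d, hd⟩ := hS f hf
  have hfI : f ∈ idealOf {p : ProjSpace K N | ∀ f ∈ S, MvPolynomial.eval p.rep f = 0} := by
    rw [mem_idealOf]
    intro q hq w hw
    obtain ⟨c, rfl⟩ := exists_smul_rep hw
    rw [aeval_smul_of_isHomogeneous hd, aeval_eq_eval, hq f hf, mul_zero]
  have h1 := mem_relIdeal.1 (h hfI)
  obtain ⟨c, hc, rfl⟩ := exists_ne_zero_smul_rep hv h0
  rw [aeval_smul_of_isHomogeneous hd, aeval_eq_eval] at h1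
  exact (mul_eq_zero.1 h1).resolve_left (pow_ne_zero d hc)

theorem isOpen_aeval_ne_zero {f : MvPolynomial (Fin (N + 1)) K} {d : ℕ} (hf : f.IsHomogeneous d) :
    IsOpen {p : ProjSpace K N | aeval p.rep f ≠ 0} := by
  rw [← isClosed_compl_iff, isClosed_iff_exists]
  refine ⟨{f}, by rintro _ rfl; exact ⟨d, hf⟩, ?_⟩
  ext p
  simp

/-- Openness may be tested with inhomogeneous polynomials: near `p` use a homogeneous component not
vanishing there. Where that component is nonzero at `q`, some nonzero multiple of `q.rep` is not a
zero of `f`. -/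
theorem exists_isOpen_eq_inter [Infinite K] {U Z : Set (ProjSpace K N)} (hUZ : U ⊆ Z)
    (h : ∀ p ∈ U, ∃ f : MvPolynomial (Fin (N + 1)) K, (∃ v ∈ p.submodule, aeval v f ≠ 0) ∧
      ∀ q ∈ Z, ∀ v ∈ q.submodule, v ≠ 0 → aeval v f ≠ 0 → q ∈ U) :
    ∃ O, IsOpen O ∧ U = O ∩ Z := by
  have key : ∀ p ∈ U, ∃ O, IsOpen O ∧ p ∈ O ∧ O ∩ Z ⊆ U := by
    intro p hp
    obtain ⟨f, ⟨v, hv, hfv⟩, hf⟩ := h p hp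
    obtain ⟨d, hd⟩ : ∃ d, aeval v (homogeneousComponent d f) ≠ 0 := by
      by_contra! hcon
      refine hfv ?_
      rw [← sum_homogeneousComponent f, map_sum]
      exact Finset.sum_eq_zero fun d _ => hcon d
    have hhom := homogeneousComponent_isHomogeneous d f
    refine ⟨_, isOpen_aeval_ne_zero hhom, ?_, ?_⟩
    · obtain ⟨c, rfl⟩ := exists_smul_rep hv
      rw [aeval_smul_of_isHomogeneous hhom] at hd
      exact right_ne_zero_of_mul hd
    · rintro q ⟨hq, hqZ⟩
      have h1 : ∃ c : K, aeval (c • q.rep) f ≠ 0 := by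
        by_contra! hcon
        refine hq ?_
        rw [← coeff_linePoly, show linePoly f q.rep = 0 from Polynomial.funext fun c => by
          rw [eval_linePoly, hcon, Polynomial.eval_zero], Polynomial.coeff_zero]
      obtain ⟨c, hc, hc', -⟩ := exists_ne_zero_smul_aeval_ne_zero h1 h1
      exact hf q hqZ _ (smul_rep_mem q c) (smul_ne_zero hc q.rep_nonzero) hc'
  choose! O hO hpO hOU using key
  refine ⟨⋃ p ∈ U, O p, isOpen_biUnion hO, Set.Subset.antisymm (fun p hp => ?_) ?_⟩
  · exact ⟨Set.mem_biUnion hp (hpO p hp), hUZ hp⟩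
  · rintro q ⟨hq, hqZ⟩
    obtain ⟨p, hp, hqp⟩ := Set.mem_iUnion₂.1 hq
    exact hOU p hp ⟨hqp, hqZ⟩

theorem exists_aeval_ne_zero_of_isOpen {O : Set (ProjSpace K N)} (hO : IsOpen O)
    {p : ProjSpace K N} (hp : p ∈ O) :
    ∃ f : MvPolynomial (Fin (N + 1)) K, aeval p.rep f ≠ 0 ∧
      ∀ q : ProjSpace K N, ∀ v ∈ q.submodule, aeval v f ≠ 0 → q ∈ O := by
  obtain ⟨S, hS, hOS⟩ := isClosed_iff_exists.1 hO.isClosed_compl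
  have hmem : ∀ q : ProjSpace K N, q ∈ O ↔ ∃ f ∈ S, aeval q.rep f ≠ 0 := fun q => by
    rw [← not_iff_not, ← Set.mem_compl_iff, hOS]
    simp
  obtain ⟨f, hf, hfp⟩ := (hmem p).1 hp
  obtain ⟨d, hd⟩ := hS f hf
  refine ⟨f, hfp, fun q v hv hfv => (hmem q).2 ⟨f, hf, ?_⟩⟩
  obtain ⟨c, rfl⟩ := exists_smul_rep hv
  rw [aeval_smul_of_isHomogeneous hd] at hfv
  exact right_ne_zero_of_mul hfv

/-- The simultaneous vanishing of the homogeneous components of `f` is a closed condition. -/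
theorem idealOf_closure [Infinite K] (S : Set (ProjSpace K N)) :
    idealOf (closure S) = idealOf S := by
  refine le_antisymm (fun f hf => mem_idealOf.2 fun p hp => mem_idealOf.1 hf p (subset_closure hp))
    fun f hf => mem_idealOf.2 fun p hp v hv => ?_
  have hcl : IsClosed {p : ProjSpace K N | ∀ d, aeval p.rep (homogeneousComponent d f) = 0} := by
    rw [Set.ofPred_forall]
    refine isClosed_iInter fun d => ?_
    rw [← isOpen_compl_iff]
    exact isOpen_aeval_ne_zero (homogeneousComponent_isHomogeneous d f)
  have h1 := closure_minimal (fun q hq d =>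
    mem_idealOf.1 (homogeneousComponent_mem_idealOf hf d) q hq _ (rep_mem q)) hcl hp
  obtain ⟨c, rfl⟩ := exists_smul_rep hv
  rw [← sum_homogeneousComponent f, map_sum]
  refine Finset.sum_eq_zero fun d _ => ?_
  rw [aeval_smul_of_isHomogeneous (homogeneousComponent_isHomogeneous d f), h1 d, mul_zero]

/-- Irreducibility provides a point on whose line neither factor vanishes identically, and a common
scalar then makes both nonzero. -/
theorem isPrime_idealOf [Infinite K] {X : Set (ProjSpace K N)} (hX : IsIrreducible X) :
    (idealOf X).IsPrime := by
  have hopen : ∀ f : MvPolynomial (Fin (N + 1)) K,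
      IsOpen {p : ProjSpace K N | ∃ c : K, aeval (c • p.rep) f ≠ 0} := by
    intro f
    obtain ⟨O, hO, h⟩ := exists_isOpen_eq_inter
      (Set.subset_univ {p : ProjSpace K N | ∃ c : K, aeval (c • p.rep) f ≠ 0}) (by
        rintro p ⟨c, hc⟩
        refine ⟨f, ⟨_, smul_rep_mem p c, hc⟩, fun q _ v hv _ hfv => ?_⟩
        obtain ⟨b, rfl⟩ := exists_smul_rep hv
        exact ⟨b, hfv⟩)
    rw [h, Set.inter_univ]
    exact hO
  have hmeet : ∀ f ∉ idealOf X,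
      (X ∩ {p : ProjSpace K N | ∃ c : K, aeval (c • p.rep) f ≠ 0}).Nonempty := by
    intro f hf
    rw [mem_idealOf] at hf
    push Not at hf
    obtain ⟨p, hp, v, hv, hfv⟩ := hf
    obtain ⟨c, rfl⟩ := exists_smul_rep hv
    exact ⟨p, hp, c, hfv⟩
  refine Ideal.isPrime_iff.2 ⟨fun htop => ?_, fun {f g} hfg => ?_⟩
  · obtain ⟨p, hp⟩ := hX.1
    have h1 : (1 : MvPolynomial (Fin (N + 1)) K) ∈ idealOf X := htop ▸ Submodule.mem_top
    simpa using mem_idealOf.1 h1 p hp _ (rep_mem p)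
  · by_contra! hcon
    obtain ⟨p, hp, hpf, hpg⟩ :=
      hX.2 _ _ (hopen f) (hopen g) (hmeet f hcon.1) (hmeet g hcon.2)
    obtain ⟨c, -, hcf, hcg⟩ := exists_ne_zero_smul_aeval_ne_zero hpf hpg
    have h1 := mem_idealOf.1 hfg p hp _ (smul_rep_mem p c)
    rw [map_mul] at h1
    exact mul_ne_zero hcf hcg h1

theorem isIrreducible_of_isPrime {X : Set (ProjSpace K N)} (hne : X.Nonempty)
    (hX : (idealOf X).IsPrime) : IsIrreducible X := by
  refine ⟨hne, fun u v hu hv ⟨p, hpX, hpu⟩ ⟨q, hqX, hqv⟩ => ?_⟩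
  obtain ⟨f, hfp, hf⟩ := exists_aeval_ne_zero_of_isOpen hu hpu
  obtain ⟨g, hgq, hg⟩ := exists_aeval_ne_zero_of_isOpen hv hqv
  have hfX : f ∉ idealOf X := fun h => hfp (mem_idealOf.1 h p hpX _ (rep_mem p))
  have hgX : g ∉ idealOf X := fun h => hgq (mem_idealOf.1 h q hqX _ (rep_mem q))
  have hfg : f * g ∉ idealOf X := fun h => (hX.mem_or_mem h).elim hfX hgX
  rw [mem_idealOf] at hfg
  push Not at hfg
  obtain ⟨y, hy, w, hw, hne⟩ := hfg
  rw [map_mul] at hne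
  exact ⟨y, hy, hf y w hw (left_ne_zero_of_mul hne), hg y w hw (right_ne_zero_of_mul hne)⟩

end Cones

/-! ### Open parts of planes, rescaling, and comparison with the projective definitions -/

noncomputable section Bridge

variable {K : Type*} [Field K] {N : ℕ}

/-- Restrict to the affine line joining the two witnesses, where both polynomials are nonzero and
`K` has enough points. -/
theorem exists_mem_aeval_ne_zero [Infinite K] {ι : Type*} {W : Submodule K (ι → K)}
    {f g : MvPolynomial ι K} (hf : ∃ w ∈ W, aeval w f ≠ 0) (hg : ∃ w ∈ W, aeval w g ≠ 0) :
    ∃ w ∈ W, aeval w f ≠ 0 ∧ aeval w g ≠ 0 := by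
  obtain ⟨u, hu, hfu⟩ := hf
  obtain ⟨v, hv, hgv⟩ := hg
  let φ : MvPolynomial ι K → Polynomial K := fun h =>
    aeval (fun i => Polynomial.C (u i) + Polynomial.X * Polynomial.C (v i - u i)) h
  have hφ : ∀ h c, (φ h).eval c = aeval (u + c • (v - u)) h := fun h c => by
    rw [← Polynomial.coe_aeval_eq_eval, comp_aeval_apply]
    congr 2
    funext i
    simp
  have h1 : φ f * φ g ≠ 0 := by
    refine mul_ne_zero (fun h0 => hfu ?_) (fun h0 => hgv ?_)
    · have := hφ f 0
      rwa [h0, Polynomial.eval_zero, zero_smul, add_zero, eq_comm] at this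
    · have := hφ g 1
      rwa [h0, Polynomial.eval_zero, one_smul, add_sub_cancel, eq_comm] at this
  obtain ⟨c, hc⟩ : ∃ c, (φ f * φ g).eval c ≠ 0 := by
    by_contra! hcon
    exact h1 (Polynomial.funext fun c => by rw [hcon c, Polynomial.eval_zero])
  rw [Polynomial.eval_mul, hφ, hφ] at hc
  exact ⟨_, W.add_mem hu (W.smul_mem c (W.sub_mem hv hu)), left_ne_zero_of_mul hc,
    right_ne_zero_of_mul hc⟩

theorem mem_idealOf_inter_plane [Infinite K] {O : Set (ProjSpace K N)} (hO : IsOpen O)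
    {W : Submodule K (Fin (N + 1) → K)} (hne : (O ∩ plane W).Nonempty)
    {f : MvPolynomial (Fin (N + 1)) K} :
    f ∈ idealOf (O ∩ plane W) ↔ ∀ w ∈ W, aeval w f = 0 := by
  refine ⟨fun hf => ?_, fun hf => mem_idealOf.2 fun p hp v hv => hf v (hp.2 hv)⟩
  by_contra! hcon
  obtain ⟨p, hpO, hpW⟩ := hne
  obtain ⟨h, hhp, hh⟩ := exists_aeval_ne_zero_of_isOpen hO hpO
  obtain ⟨i, hi⟩ := Function.ne_iff.1 p.rep_nonzero
  have hpW' : p.rep ∈ W := hpW (rep_mem p)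
  -- The factor `h` keeps the point inside `O`; the factor `X i` keeps `w` away from the origin.
  obtain ⟨w, hw, hfw, hgw⟩ := exists_mem_aeval_ne_zero (g := h * X i) hcon ⟨p.rep, hpW', by
    rw [map_mul, aeval_X]; exact mul_ne_zero hhp hi⟩
  rw [map_mul, aeval_X] at hgw
  have hw0 : w ≠ 0 := fun h0 => right_ne_zero_of_mul hgw (by rw [h0]; rfl)
  obtain ⟨q, hq⟩ := exists_point_of_ne_zero hw0
  refine hfw (mem_idealOf.1 hf q ⟨hh q w hq (left_ne_zero_of_mul hgw), ?_⟩ w hq)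
  obtain ⟨c, hc, rfl⟩ := exists_ne_zero_smul_rep hq hw0
  refine submodule_le_iff_rep_mem.2 ?_
  have := W.smul_mem c⁻¹ hw
  rwa [smul_smul, inv_mul_cancel₀ hc, one_smul] at this

theorem linSpan_inter_plane [Infinite K] {O : Set (ProjSpace K N)} (hO : IsOpen O)
    {W : Submodule K (Fin (N + 1) → K)} (hne : (O ∩ plane W).Nonempty) :
    linSpan (O ∩ plane W) = W := by
  refine le_antisymm (Submodule.span_le.2 ?_) ?_
  · rintro v ⟨p, hp, hv⟩
    exact hp.2 hv
  · rw [← dotAnn_dotAnn (linSpan (O ∩ plane W)), le_dotAnn_comm]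
    intro ξ hξ w hw
    have h1 : (∑ i, C (ξ i) * X i : MvPolynomial (Fin (N + 1)) K) ∈ idealOf (O ∩ plane W) := by
      refine mem_idealOf.2 fun p hp v hv => ?_
      have := hξ v (Submodule.subset_span ⟨p, hp, hv⟩)
      simpa [dotProduct] using this
    have h2 := (mem_idealOf_inter_plane hO hne).1 h1 w hw
    simpa [dotProduct] using h2

theorem projDim_inter_plane [Infinite K] {O : Set (ProjSpace K N)} (hO : IsOpen O)
    {W : Submodule K (Fin (N + 1) → K)} (hne : (O ∩ plane W).Nonempty) :
    projDim (O ∩ plane W) = (finrank K W : ℤ) - 1 := by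
  let b := Module.finBasis K W
  let d := finrank K W
  let L := FractionRing (MvPolynomial (Fin d) K)
  have hinj : Function.Injective (algebraMap (MvPolynomial (Fin d) K) L) :=
    IsFractionRing.injective _ _
  let s : Fin d → L := fun a => algebraMap (MvPolynomial (Fin d) K) L (X a)
  have hs : AlgebraicIndependent K s :=
    (MvPolynomial.algebraicIndependent_X (Fin d) K).map'
      (f := IsScalarTower.toAlgHom K (MvPolynomial (Fin d) K) L) hinj
  -- A generic combination of a basis is a generic point of `W`. An invertible minor of the basis
  -- recovers the variables from its coordinates, so the coordinate ring is a polynomial ring in `d`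
  -- variables.
  let η' : Fin (N + 1) → MvPolynomial (Fin d) K :=
    fun i => ∑ a, X a * C ((b a : Fin (N + 1) → K) i)
  let η : Fin (N + 1) → L := fun i => algebraMap (MvPolynomial (Fin d) K) L (η' i)
  have hrel : idealOf (O ∩ plane W) = relIdeal K η := by
    ext f
    have h1 : aeval η f = algebraMap (MvPolynomial (Fin d) K) L (aeval η' f) :=
      (comp_aeval_apply (R := K) (f := η')
        (IsScalarTower.toAlgHom K (MvPolynomial (Fin d) K) L) f).symm
    have h2 : ∀ c : Fin d → K,
        aeval c (aeval η' f) = aeval (∑ a, c a • (b a : Fin (N + 1) → K)) f := fun c => by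
      rw [comp_aeval_apply]
      congr 2
      funext i
      simp [η']
      rfl
    rw [mem_idealOf_inter_plane hO hne, mem_relIdeal, h1, map_eq_zero_iff _ hinj]
    constructor
    · intro h
      refine MvPolynomial.funext fun c => ?_
      rw [← aeval_eq_eval, h2, map_zero]
      exact h _ (sum_mem fun a _ => W.smul_mem _ (b a).2)
    · intro h w hw
      have h3 := b.sum_repr ⟨w, hw⟩
      have h4 : w = ∑ a, b.repr ⟨w, hw⟩ a • (b a : Fin (N + 1) → K) := by
        have h5 := congrArg W.subtype h3
        rw [map_sum] at h5
        exact h5.symm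
      rw [h4, ← h2, h, map_zero]
  have hadj : Algebra.adjoin K (Set.range η) = Algebra.adjoin K (Set.range s) := by
    refine le_antisymm (Algebra.adjoin_le ?_) (Algebra.adjoin_le ?_)
    · rintro _ ⟨i, rfl⟩
      have : η i = ∑ a, (b a : Fin (N + 1) → K) i • s a := by
        simp only [η, η', map_sum, map_mul, s]
        refine Finset.sum_congr rfl fun a _ => ?_
        rw [Algebra.smul_def, mul_comm]
        congr 1
      rw [this]
      exact sum_mem fun a _ => Subalgebra.smul_mem _ (Algebra.subset_adjoin (Set.mem_range_self a)) _
    · rintro _ ⟨a, rfl⟩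
      have hli : LinearIndependent K fun a => (b a : Fin (N + 1) → K) :=
        b.linearIndependent.map' W.subtype (Submodule.ker_subtype _)
      obtain ⟨c, hc⟩ := (linearIndependent_iff_exists_minor _).1 hli
      set A : Matrix (Fin d) (Fin d) K :=
        Matrix.of fun i j => (b i : Fin (N + 1) → K) (c j) with hA
      have h1 : ∀ a, (X a : MvPolynomial (Fin d) K) = ∑ j, C (A⁻¹ j a) * η' (c j) := by
        intro a
        have h2 : ∀ e, ∑ j, A⁻¹ j a * A e j = if e = a then 1 else 0 := fun e => by
          have := congrFun (congrFun (Matrix.mul_nonsing_inv A (isUnit_iff_ne_zero.2 hc)) e) a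
          rw [Matrix.mul_apply, Matrix.one_apply] at this
          rw [← this]
          exact Finset.sum_congr rfl fun j _ => mul_comm _ _
        have h3 : ∀ j, η' (c j) = ∑ e, X e * C (A e j) := fun j => rfl
        simp only [h3, Finset.mul_sum]
        rw [Finset.sum_comm]
        have h4 : ∀ e, ∑ j, (C (A⁻¹ j a) * (X e * C (A e j)) : MvPolynomial (Fin d) K) =
            X e * C (∑ j, A⁻¹ j a * A e j) := fun e => by
          rw [map_sum, Finset.mul_sum]
          refine Finset.sum_congr rfl fun j _ => ?_
          rw [C_mul]
          ring
        simp only [h4, h2]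
        simp
      have h2 : s a = ∑ j, A⁻¹ j a • η (c j) := by
        simp only [s, η]
        rw [h1 a, map_sum]
        refine Finset.sum_congr rfl fun j _ => ?_
        rw [map_mul, Algebra.smul_def]
        congr 1
      rw [h2]
      exact sum_mem fun j _ => Subalgebra.smul_mem _ (Algebra.subset_adjoin (Set.mem_range_self (c j))) _
  rw [projDim, hrel, toNat_trdeg_quotient_relIdeal, hadj, ← Cardinal.toNat_lift,
    ← AlgEquiv.lift_trdeg_eq hs.aevalEquiv, Cardinal.toNat_lift, MvPolynomial.trdeg_of_isDomain]
  simp only [Cardinal.mk_fin, Cardinal.lift_natCast, Cardinal.toNat_natCast, d]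

/-- The substitution `x ↦ c x`. -/
def dilate {ι : Type*} (c : K) : MvPolynomial ι K →ₐ[K] MvPolynomial ι K :=
  aeval fun i => C c * X i

theorem aeval_dilate {ι : Type*} (c : K) (f : MvPolynomial ι K) (v : ι → K) :
    aeval v (dilate c f) = aeval (c • v) f := by
  rw [dilate, comp_aeval_apply]
  congr 2
  funext i
  simp

theorem pderiv_dilate {ι : Type*} (c : K) (f : MvPolynomial ι K) (i : ι) :
    pderiv i (dilate c f) = C c * dilate c (pderiv i f) := by
  classical
  induction f using MvPolynomial.induction_on with
  | C a => simp [dilate]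
  | add p q hp hq => simp only [map_add, hp, hq, mul_add]
  | mul_X p j hp =>
    have hX : ∀ j, dilate c (X j : MvPolynomial ι K) = C c * X j := fun j => aeval_X _ _
    simp only [map_mul, hX, Derivation.leibniz, hp, smul_eq_mul, map_add, pderiv_X, pderiv_C,
      Pi.single_apply]
    split_ifs <;> simp <;> ring

theorem dilate_mem_idealOf {S : Set (ProjSpace K N)} {f : MvPolynomial (Fin (N + 1)) K}
    (hf : f ∈ idealOf S) (c : K) : dilate c f ∈ idealOf S :=
  mem_idealOf.2 fun p hp v hv => by
    rw [aeval_dilate]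
    exact mem_idealOf.1 hf p hp _ (p.submodule.smul_mem c hv)

theorem grad_dilate {ι : Type*} (c : K) (f : MvPolynomial ι K) (v : ι → K) :
    grad (dilate c f) v = c • grad f (c • v) := by
  funext i
  simp only [grad, pderiv_dilate, map_mul, aeval_dilate, aeval_C, Pi.smul_apply, smul_eq_mul]
  rfl

theorem hess_dilate {ι : Type*} [Fintype ι] (c : K) (f : MvPolynomial ι K) (v w : ι → K) :
    hess (dilate c f) v w = c ^ 2 • hess f (c • v) w := by
  funext j
  simp only [hess, pderiv_dilate, pderiv_C_mul, map_mul, aeval_dilate, aeval_C, Pi.smul_apply,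
    smul_eq_mul, Finset.mul_sum, Algebra.algebraMap_self, RingHom.id_apply]
  exact Finset.sum_congr rfl fun i _ => by ring

/-- Conormal spaces are computed at a chosen representative; this and its companions remove that
choice. The ideal of a cone is stable under `dilate`, whose gradient is the gradient at the rescaled
point up to a nonzero factor. -/
theorem conormal_smul_le (S : Set (ProjSpace K N)) {c : K} (hc : c ≠ 0) (v : Fin (N + 1) → K) :
    conormal (idealOf S) (c • v) ≤ conormal (idealOf S) v := by
  rw [conormal_le]
  intro f hf
  have h := (conormal (idealOf S) v).smul_mem c⁻¹ (grad_mem_conormal (dilate_mem_idealOf hf c) v)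
  rwa [grad_dilate, smul_smul, inv_mul_cancel₀ hc, one_smul] at h

theorem conormal_smul (S : Set (ProjSpace K N)) {c : K} (hc : c ≠ 0) (v : Fin (N + 1) → K) :
    conormal (idealOf S) (c • v) = conormal (idealOf S) v := by
  refine le_antisymm (conormal_smul_le S hc v) ?_
  have := conormal_smul_le S (inv_ne_zero hc) (c • v)
  rwa [smul_smul, inv_mul_cancel₀ hc, one_smul] at this

theorem gaussKer_smul_le (S : Set (ProjSpace K N)) {c : K} (hc : c ≠ 0) (v : Fin (N + 1) → K) :
    gaussKer (idealOf S) v ≤ gaussKer (idealOf S) (c • v) := by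
  intro w hw
  rw [mem_gaussKer_iff_hess_mem, tangent, conormal_smul S hc] at *
  refine ⟨hw.1, fun f hf => ?_⟩
  have h := (conormal (idealOf S) v).smul_mem (c ^ 2)⁻¹ (hw.2 _ (dilate_mem_idealOf hf c))
  rwa [hess_dilate, smul_smul, inv_mul_cancel₀ (pow_ne_zero 2 hc), one_smul] at h

theorem gaussKer_smul (S : Set (ProjSpace K N)) {c : K} (hc : c ≠ 0) (v : Fin (N + 1) → K) :
    gaussKer (idealOf S) (c • v) = gaussKer (idealOf S) v := by
  refine le_antisymm ?_ (gaussKer_smul_le S hc v)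
  have := gaussKer_smul_le S (inv_ne_zero hc) (c • v)
  rwa [smul_smul, inv_mul_cancel₀ hc, one_smul] at this

theorem tangentSpace_eq (X : Set (ProjSpace K N)) (p : ProjSpace K N) :
    tangentSpace X p = tangent (idealOf X) p.rep := by
  ext v
  rw [mem_tangent]
  rfl

theorem dualSubspace_eq (W : Submodule K (Fin (N + 1) → K)) : dualSubspace W = dotAnn W := rfl

theorem dualSubspace_tangentSpace (X : Set (ProjSpace K N)) (p : ProjSpace K N) :
    dualSubspace (tangentSpace X p) = conormal (idealOf X) p.rep := by
  rw [tangentSpace_eq, dualSubspace_eq, dotAnn_tangent]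

theorem isTangentAt_iff (X : Set (ProjSpace K N)) (ξ p : ProjSpace K N) :
    IsTangentAt X ξ p ↔ ξ.rep ∈ conormal (idealOf X) p.rep := by
  rw [← dualSubspace_tangentSpace]
  rfl

theorem finrank_range_gaussDifferential_add (X : Set (ProjSpace K N)) (p : ProjSpace K N) :
    finrank K (LinearMap.range (gaussDifferential X p)) +
      finrank K (gaussKer (idealOf X) p.rep) = finrank K (tangent (idealOf X) p.rep) := by
  rw [← tangentSpace_eq, ← LinearMap.finrank_range_add_finrank_ker (gaussDifferential X p)]
  congr 1
  have hT : gaussKer (idealOf X) p.rep =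
      (LinearMap.ker (gaussDifferential X p)).map (tangentSpace X p).subtype := by
    have happ : ∀ (v w : tangentSpace X p) (f : idealOf X), gaussDifferential X p v w f =
        hessBilin (idealOf X) p.rep v w f := by
      intro v w f
      rw [hessBilin_apply]
      simp only [hess, dotProduct, Finset.sum_mul]
      rw [Finset.sum_comm]
      rfl
    ext v
    rw [mem_gaussKer, ← tangentSpace_eq]
    constructor
    · rintro ⟨hv, h⟩
      refine ⟨⟨v, hv⟩, LinearMap.mem_ker.2 (LinearMap.ext fun w => funext fun f => ?_), rfl⟩
      rw [happ, h w w.2]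
      rfl
    · rintro ⟨v, hv, rfl⟩
      refine ⟨v.2, fun w hw => funext fun f => ?_⟩
      have := congrFun (LinearMap.congr_fun (LinearMap.mem_ker.1 hv) ⟨w, hw⟩) f
      rw [happ] at this
      exact this
  rw [hT, Submodule.finrank_map_subtype_eq]

/-- Euler's formula on each homogeneous component: these components belong to the ideal since `K` is
infinite. -/
theorem grad_dotProduct_self [Infinite K] {S : Set (ProjSpace K N)} {L : Type*} [Field L]
    [Algebra K L] {η : Fin (N + 1) → L} (hη : idealOf S ≤ relIdeal K η)
    {f : MvPolynomial (Fin (N + 1)) K} (hf : f ∈ idealOf S) : grad f η ⬝ᵥ η = 0 := by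
  have h1 : ∑ i, X i * pderiv i f ∈ idealOf S := by
    have h2 : ∑ i, X i * pderiv i f =
        ∑ d ∈ Finset.range (f.totalDegree + 1), d • homogeneousComponent d f := by
      conv_lhs => rw [← sum_homogeneousComponent f]
      simp only [map_sum, Finset.mul_sum]
      rw [Finset.sum_comm]
      exact Finset.sum_congr rfl fun d _ =>
        (homogeneousComponent_isHomogeneous d f).sum_X_mul_pderiv
    rw [h2]
    exact sum_mem fun d _ => nsmul_mem (homogeneousComponent_mem_idealOf hf d) d
  have h3 := mem_relIdeal.1 (hη h1)
  rw [map_sum] at h3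
  rw [← h3]
  simp only [map_mul, aeval_X, dotProduct, grad]
  exact Finset.sum_congr rfl fun i _ => mul_comm _ _

theorem projDim_eq [CharZero K] {X : Set (ProjSpace K N)} {L : Type*} [Field L] [Algebra K L]
    [Algebra.EssFiniteType K L] {η : Fin (N + 1) → L} (hη : idealOf X = relIdeal K η) :
    projDim X = (finrank L (tangent (idealOf X) η) : ℤ) - 1 := by
  rw [projDim, hη, toNat_trdeg_quotient_relIdeal, ← finrank_tangent_relIdeal,
    Cardinal.toNat_natCast]

theorem mem_smoothLocus_iff [CharZero K] {X : Set (ProjSpace K N)} {L : Type*} [Field L]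
    [Algebra K L] [Algebra.EssFiniteType K L] {η : Fin (N + 1) → L}
    (hη : idealOf X = relIdeal K η) {p : ProjSpace K N} : p ∈ smoothLocus X ↔
      p ∈ X ∧ finrank L (conormal (idealOf X) η) = finrank K (conormal (idealOf X) p.rep) := by
  refine and_congr_right fun _ => ?_
  rw [projDim_eq hη, tangentSpace_eq]
  have h1 := finrank_tangent_add (idealOf X) p.rep
  have h2 := finrank_tangent_add (idealOf X) η
  omega

end Bridge

/-! ### Specialization to points over the base field, regular loci and leaves -/

noncomputable section Contact

section Affine

variable {K : Type*} [Field K] {L : Type*} [Field L] [Algebra K L] {ι : Type*}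

theorem valSpan_rename_inl {J κ : Type*} (a : J → κ → MvPolynomial ι K) (x ξ : ι → L) :
    valSpan (fun j k => rename (Sum.inl : ι → ι ⊕ ι) (a j k)) (Sum.elim x ξ) = valSpan a x := by
  simp only [valSpan, aeval_rename, Sum.elim_comp_inl]

/-- The gradients involve only the first block of variables while `b` may involve both, so constancy
of the conormal rank is needed on the first side only. -/
theorem mem_conormal_of_sumElim_le [Finite ι] {I : Ideal (MvPolynomial ι K)} {x ξ : ι → L}
    {x₀ ξ₀ : ι → K} (hle : relIdeal K (Sum.elim x ξ) ≤ relIdeal K (Sum.elim x₀ ξ₀))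
    (hr : finrank L (conormal I x) ≤ finrank K (conormal I x₀)) (b : ι → MvPolynomial (ι ⊕ ι) K)
    (hb : (fun i => aeval (Sum.elim x ξ) (b i)) ∈ conormal I x) :
    (fun i => aeval (Sum.elim x₀ ξ₀) (b i)) ∈ conormal I x₀ := by
  have h := mem_valSpan_of_relIdeal_le
    (fun (f : I) i => rename (Sum.inl : ι → ι ⊕ ι) (pderiv i (f : MvPolynomial ι K))) b hle
    (by rw [valSpan_rename_inl, valSpan_rename_inl]; exact hr)
    (by rw [valSpan_rename_inl]; exact hb)
  rw [valSpan_rename_inl] at h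
  exact h

variable [Fintype ι]

/-- Tangency of `∇g(ξ)` at `x` is a polynomial relation of the pair, and the Hessian condition is
membership in the conormal space; both specialize. -/
theorem conormal_le_gaussKer_of_sumElim_le {I J : Ideal (MvPolynomial ι K)} {x ξ : ι → L}
    {x₀ ξ₀ : ι → K} (hle : relIdeal K (Sum.elim x ξ) ≤ relIdeal K (Sum.elim x₀ ξ₀))
    (hr : finrank L (conormal I x) ≤ finrank K (conormal I x₀))
    (hker : conormal J ξ ≤ gaussKer I x) : conormal J ξ₀ ≤ gaussKer I x₀ := by
  rw [conormal_le]
  intro g hg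
  have hv := hker (grad_mem_conormal hg ξ)
  rw [mem_gaussKer_iff_hess_mem] at hv ⊢
  constructor
  · rw [mem_tangent] at hv ⊢
    intro f hf
    have h1 := hle (show ∑ i, rename Sum.inl (pderiv i f) * rename Sum.inr (pderiv i g) ∈
        relIdeal K (Sum.elim x ξ) by
      rw [mem_relIdeal, ← hv.1 f hf]
      simp [dotProduct, grad, aeval_rename])
    rw [mem_relIdeal] at h1
    simp only [map_sum, map_mul, aeval_rename, Sum.elim_comp_inl, Sum.elim_comp_inr] at h1
    exact h1
  · intro f hf
    have key : ∀ (M : Type _) [Field M] [Algebra K M] (y ζ : ι → M),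
        (fun j => aeval (Sum.elim y ζ)
          (∑ i, rename Sum.inl (pderiv i (pderiv j f)) * rename Sum.inr (pderiv i g))) =
        hess f y (grad g ζ) := fun M _ _ y ζ => by
      funext j
      simp only [map_sum, map_mul, aeval_rename, Sum.elim_comp_inl, Sum.elim_comp_inr]
      rfl
    have key' : (fun j => aeval (Sum.elim x ξ)
          (∑ i, rename Sum.inl (pderiv i (pderiv j f)) * rename Sum.inr (pderiv i g))) =
        hess f x (grad g ξ) := by
      funext j
      simp only [map_sum, map_mul, aeval_rename, Sum.elim_comp_inl, Sum.elim_comp_inr]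
      rfl
    rw [← key]
    refine mem_conormal_of_sumElim_le hle hr _ ?_
    rw [key']
    exact hv.2 f hf

end Affine

variable {K : Type*} [Field K] {L : Type*} [Field L] [Algebra K L] {N : ℕ}

theorem relIdeal_le_of_mem {X : Set (ProjSpace K N)} {x : Fin (N + 1) → L}
    (hX : idealOf X = relIdeal K x) {p : ProjSpace K N} (hp : p ∈ X) {v : Fin (N + 1) → K}
    (hv : v ∈ p.submodule) : relIdeal K x ≤ relIdeal K v :=
  hX ▸ idealOf_le_relIdeal hp hv

theorem exists_mem_aeval_ne_zero_of_generic {X : Set (ProjSpace K N)} {x : Fin (N + 1) → L}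
    (hX : idealOf X = relIdeal K x) (hne : x ≠ 0) {f : MvPolynomial (Fin (N + 1)) K}
    (hf : aeval x f ≠ 0) : ∃ p ∈ X, ∃ v ∈ p.submodule, v ≠ 0 ∧ aeval v f ≠ 0 := by
  obtain ⟨i, hi⟩ := Function.ne_iff.1 hne
  have h1 : f * MvPolynomial.X i ∉ idealOf X := by
    rw [hX, mem_relIdeal, map_mul, aeval_X]
    exact mul_ne_zero hf hi
  rw [mem_idealOf] at h1
  push Not at h1
  obtain ⟨p, hp, v, hv, hne⟩ := h1
  rw [map_mul, aeval_X] at hne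
  exact ⟨p, hp, v, hv, fun h0 => right_ne_zero_of_mul hne (by rw [h0]; rfl),
    left_ne_zero_of_mul hne⟩

variable {X Y : Set (ProjSpace K N)} {x ξ : Fin (N + 1) → L}

theorem IsConormalPair.sumElim_le (h : IsConormalPair K x ξ) (hX : idealOf X = relIdeal K x)
    {p : ProjSpace K N} (hp : p ∈ X) {v : Fin (N + 1) → K}
    (hv : v ∈ conormal (idealOf X) p.rep) :
    relIdeal K (Sum.elim x ξ) ≤ relIdeal K (Sum.elim p.rep v) := by
  refine h.spec_left _ _ (relIdeal_le_of_mem hX hp (rep_mem p)) ?_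
  rw [← hX]
  exact hv

/-- A covector conormal at a point of `X`, even a singular one, is a specialization of `ξ`, hence
lies in the closed set with that generic point. -/
theorem IsConormalPair.mem_dual (h : IsConormalPair K x ξ) (hX : idealOf X = relIdeal K x)
    (hY : idealOf Y = relIdeal K ξ) (hYc : IsClosed Y) {p q : ProjSpace K N} (hp : p ∈ X)
    {v : Fin (N + 1) → K} (hv : v ∈ conormal (idealOf X) p.rep) (hq : v ∈ q.submodule)
    (h0 : v ≠ 0) : q ∈ Y := by
  refine mem_of_isClosed hYc hq h0 ?_
  rw [hY]
  exact relIdeal_le_of_sumElim_le (relIdeal_sumElim_swap (h.sumElim_le hX hp hv))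

variable [CharZero K] [Algebra.EssFiniteType K L]

/-- The smooth points at which the kernel of the differential of the Gauss map has affine
dimension `k`. -/
def regularLocus (X : Set (ProjSpace K N)) (k : ℕ) : Set (ProjSpace K N) :=
  {p | p ∈ smoothLocus X ∧ finrank K (gaussKer (idealOf X) p.rep) = k}

theorem mem_smoothLocus_of_le {X : Set (ProjSpace K N)} {x : Fin (N + 1) → L}
    (hX : idealOf X = relIdeal K x) {p : ProjSpace K N} (hp : p ∈ X) {v : Fin (N + 1) → K}
    (hv : v ∈ p.submodule) (h0 : v ≠ 0)
    (h : finrank L (conormal (idealOf X) x) ≤ finrank K (conormal (idealOf X) v)) :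
    p ∈ smoothLocus X := by
  refine (mem_smoothLocus_iff hX).2 ⟨hp, le_antisymm ?_ ?_⟩
  · obtain ⟨c, hc, rfl⟩ := exists_ne_zero_smul_rep hv h0
    rwa [conormal_smul X hc] at h
  · exact finrank_conormal_le (relIdeal_le_of_mem hX hp (rep_mem p))

theorem exists_smooth_of_aeval_ne_zero {X : Set (ProjSpace K N)} {x : Fin (N + 1) → L}
    (hX : idealOf X = relIdeal K x) {p : ProjSpace K N} (hp : p ∈ smoothLocus X) :
    ∃ f : MvPolynomial (Fin (N + 1)) K, aeval p.rep f ≠ 0 ∧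
      ∀ q ∈ X, ∀ v ∈ q.submodule, v ≠ 0 → aeval v f ≠ 0 → q ∈ smoothLocus X := by
  obtain ⟨f, hf, h⟩ := exists_forall_finrank_conormal_le (L' := K) (idealOf X) p.rep
  refine ⟨f, hf, fun q hq v hv h0 hfv => mem_smoothLocus_of_le hX hq hv h0 ?_⟩
  rw [((mem_smoothLocus_iff hX).1 hp).2]
  exact h v hfv

theorem isOpen_smoothLocus {X : Set (ProjSpace K N)} {x : Fin (N + 1) → L}
    (hX : idealOf X = relIdeal K x) : ∃ O, IsOpen O ∧ smoothLocus X = O ∩ X := by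
  refine exists_isOpen_eq_inter (fun p hp => hp.1) fun p hp => ?_
  obtain ⟨f, hf, h⟩ := exists_smooth_of_aeval_ne_zero hX hp
  exact ⟨f, ⟨_, rep_mem p, hf⟩, h⟩

theorem mem_regularLocus_of_aeval_ne_zero {X : Set (ProjSpace K N)} {x : Fin (N + 1) → L}
    (hX : idealOf X = relIdeal K x) {f g : MvPolynomial (Fin (N + 1)) K}
    (hf : ∀ q ∈ X, ∀ v ∈ q.submodule, v ≠ 0 → aeval v f ≠ 0 → q ∈ smoothLocus X)
    (hg : ∀ z : Fin (N + 1) → K, relIdeal K x ≤ relIdeal K z →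
      finrank L (conormal (idealOf X) x) = finrank K (conormal (idealOf X) z) → aeval z g ≠ 0 →
      finrank K (gaussKer (idealOf X) z) = finrank L (gaussKer (idealOf X) x)) :
    ∀ q ∈ X, ∀ v ∈ q.submodule, v ≠ 0 → aeval v (f * g) ≠ 0 →
      q ∈ regularLocus X (finrank L (gaussKer (idealOf X) x)) := by
  intro q hq v hv h0 hfg
  rw [map_mul] at hfg
  have hs := hf q hq v hv h0 (left_ne_zero_of_mul hfg)
  obtain ⟨c, hc, rfl⟩ := exists_ne_zero_smul_rep hv h0
  refine ⟨hs, ?_⟩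
  rw [← hg _ (relIdeal_le_of_mem hX hq hv) ?_ (right_ne_zero_of_mul hfg), gaussKer_smul X hc]
  rw [conormal_smul X hc]
  exact ((mem_smoothLocus_iff hX).1 hs).2

theorem exists_generic_regular {X : Set (ProjSpace K N)} {x : Fin (N + 1) → L}
    (hX : idealOf X = relIdeal K x) (hne : x ≠ 0) :
    ∃ f : MvPolynomial (Fin (N + 1)) K, aeval x f ≠ 0 ∧
      ∀ q ∈ X, ∀ v ∈ q.submodule, v ≠ 0 → aeval v f ≠ 0 →
        q ∈ regularLocus X (finrank L (gaussKer (idealOf X) x)) := by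
  obtain ⟨f, hf, h⟩ := exists_forall_finrank_conormal_le (L' := K) (idealOf X) x
  obtain ⟨p, hp, v, hv, h0, hfv⟩ := exists_mem_aeval_ne_zero_of_generic hX hne hf
  have hps := mem_smoothLocus_of_le hX hp hv h0 (h v hfv)
  obtain ⟨⟨g, hg, hg'⟩, -⟩ := exists_forall_finrank_gaussKer_eq
    (relIdeal_le_of_mem hX hp (rep_mem p)) ((mem_smoothLocus_iff hX).1 hps).2
  refine ⟨f * g, by rw [map_mul]; exact mul_ne_zero hf hg,
    mem_regularLocus_of_aeval_ne_zero hX (fun q hq v hv h0 hfv => ?_) hg'⟩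
  exact mem_smoothLocus_of_le hX hq hv h0 (h v hfv)

theorem exists_regular_of_mem_regularLocus {X : Set (ProjSpace K N)} {x : Fin (N + 1) → L}
    (hX : idealOf X = relIdeal K x) {p : ProjSpace K N}
    (hp : p ∈ regularLocus X (finrank L (gaussKer (idealOf X) x))) :
    ∃ f : MvPolynomial (Fin (N + 1)) K, aeval p.rep f ≠ 0 ∧
      ∀ q ∈ X, ∀ v ∈ q.submodule, v ≠ 0 → aeval v f ≠ 0 →
        q ∈ regularLocus X (finrank L (gaussKer (idealOf X) x)) := by
  obtain ⟨f, hf, h⟩ := exists_smooth_of_aeval_ne_zero hX hp.1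
  obtain ⟨-, hreg⟩ := exists_forall_finrank_gaussKer_eq
    (relIdeal_le_of_mem hX hp.1.1 (rep_mem p)) ((mem_smoothLocus_iff hX).1 hp.1).2
  obtain ⟨g, hg, hg'⟩ := hreg hp.2
  exact ⟨f * g, by rw [map_mul]; exact mul_ne_zero hf hg,
    mem_regularLocus_of_aeval_ne_zero hX h hg'⟩

/-- Semicontinuity bounds the rank at every smooth point by the generic one, and a regular point
over `K` attains the bound. -/
theorem gaussRank_add_eq {X : Set (ProjSpace K N)} {x : Fin (N + 1) → L}
    (hX : idealOf X = relIdeal K x) (hne : x ≠ 0) :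
    gaussRank X + finrank L (gaussKer (idealOf X) x) = finrank L (tangent (idealOf X) x) := by
  obtain ⟨f, hf, h⟩ := exists_generic_regular hX hne
  obtain ⟨p, hp, v, hv, h0, hfv⟩ := exists_mem_aeval_ne_zero_of_generic hX hne hf
  have hpr := h p hp v hv h0 hfv
  have hle : ∀ q : smoothLocus X, finrank K (LinearMap.range (gaussDifferential X q)) +
      finrank L (gaussKer (idealOf X) x) ≤ finrank L (tangent (idealOf X) x) := fun q => by
    have hq := (mem_smoothLocus_iff hX).1 q.2
    have h1 := finrank_range_gaussDifferential_add X q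
    have h2 := finrank_gaussKer_le (relIdeal_le_of_mem hX hq.1 (rep_mem _)) hq.2
    have h3 := finrank_tangent_eq_of_finrank_conormal_eq hq.2
    omega
  have hbdd : BddAbove (Set.range fun q : smoothLocus X =>
      finrank K (LinearMap.range (gaussDifferential X q))) := by
    refine ⟨finrank L (tangent (idealOf X) x), ?_⟩
    rintro _ ⟨q, rfl⟩
    have := hle q
    simp only
    omega
  have : Nonempty (smoothLocus X) := ⟨⟨p, hpr.1⟩⟩
  have h1 : gaussRank X ≤ finrank L (tangent (idealOf X) x) - finrank L (gaussKer (idealOf X) x) :=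
    ciSup_le fun q => by have := hle q; omega
  have h2 : finrank K (LinearMap.range (gaussDifferential X p)) ≤ gaussRank X :=
    le_ciSup hbdd ⟨p, hpr.1⟩
  have h3 := finrank_range_gaussDifferential_add X p
  have h4 := finrank_tangent_eq_of_finrank_conormal_eq ((mem_smoothLocus_iff hX).1 hpr.1).2
  have h5 := hpr.2
  have h6 := Submodule.finrank_mono (gaussKer_le_tangent (idealOf X) x)
  omega

/-- Reflexivity at actual points: the relation holds for the generic pair, and smoothness of `q`
keeps the conormal rank of `Y`, so it specializes. -/
theorem IsConormalPair.rep_mem_conormal_comm (h : IsConormalPair K x ξ)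
    (hX : idealOf X = relIdeal K x) (hY : idealOf Y = relIdeal K ξ) {p q : ProjSpace K N}
    (hp : p ∈ X) (hq : q ∈ smoothLocus Y) (hpq : q.rep ∈ conormal (idealOf X) p.rep) :
    p.rep ∈ conormal (idealOf Y) q.rep := by
  have hle := relIdeal_sumElim_swap (h.sumElim_le hX hp hpq)
  have h1 := mem_conormal_of_sumElim_le (I := idealOf Y) hle ((mem_smoothLocus_iff hY).1 hq).2.le
    (fun i => MvPolynomial.X (Sum.inr i)) (by
      simp only [aeval_X, Sum.elim_inr, hY]
      exact h.mem_right)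
  simpa only [aeval_X, Sum.elim_inr] using h1

theorem IsConormalPair.conormal_le_gaussKer_rep (h : IsConormalPair K x ξ)
    (hX : idealOf X = relIdeal K x)
    (hker : conormal (idealOf Y) ξ ≤ gaussKer (idealOf X) x) {p q : ProjSpace K N}
    (hp : p ∈ smoothLocus X) (hpq : q.rep ∈ conormal (idealOf X) p.rep) :
    conormal (idealOf Y) q.rep ≤ gaussKer (idealOf X) p.rep :=
  conormal_le_gaussKer_of_sumElim_le (h.sumElim_le hX hp.1 hpq)
    ((mem_smoothLocus_iff hX).1 hp).2.le hker

theorem IsConormalPair.conormal_eq_gaussKer_rep (h : IsConormalPair K x ξ)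
    (hX : idealOf X = relIdeal K x) (hY : idealOf Y = relIdeal K ξ)
    (hker : conormal (idealOf Y) ξ = gaussKer (idealOf X) x) {p q : ProjSpace K N}
    (hp : p ∈ regularLocus X (finrank L (gaussKer (idealOf X) x))) (hq : q ∈ smoothLocus Y)
    (hpq : q.rep ∈ conormal (idealOf X) p.rep) :
    conormal (idealOf Y) q.rep = gaussKer (idealOf X) p.rep := by
  refine Submodule.eq_of_le_of_finrank_eq (h.conormal_le_gaussKer_rep hX hker.le hp.1 hpq) ?_
  rw [hp.2, ← hker, ((mem_smoothLocus_iff hY).1 hq).2]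

/-- The leaf through a regular point is cut out by the conormal space of the dual variety. -/
theorem IsConormalPair.leaf_eq (h : IsConormalPair K x ξ) (hX : idealOf X = relIdeal K x)
    (hY : idealOf Y = relIdeal K ξ) (hYc : IsClosed Y)
    (hker : conormal (idealOf Y) ξ = gaussKer (idealOf X) x) {p q : ProjSpace K N}
    (hp : p ∈ regularLocus X (finrank L (gaussKer (idealOf X) x))) (hq : q ∈ smoothLocus Y)
    (hpq : q.rep ∈ conormal (idealOf X) p.rep) :
    leaf X p = smoothLocus X ∩ plane (conormal (idealOf Y) q.rep) := by
  ext y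
  constructor
  · rintro ⟨hy, hT⟩
    refine ⟨hy, submodule_le_iff_rep_mem.2 (h.rep_mem_conormal_comm hX hY hy.1 hq ?_)⟩
    rw [← dualSubspace_tangentSpace, hT, dualSubspace_tangentSpace]
    exact hpq
  · rintro ⟨hy, hyq⟩
    rw [plane, Set.mem_ofPred_eq, submodule_le_iff_rep_mem] at hyq
    refine ⟨hy, ?_⟩
    -- Smooth points `q'` of `Y` fill a nonempty open part of the plane of hyperplanes tangent at
    -- `p`, so they span it. The conormal space of `Y` is the same Gauss kernel at each of them, so
    -- it contains `y`; by reflexivity `q'` is tangent to `X` at `y`.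
    have hle : conormal (idealOf X) p.rep ≤ conormal (idealOf X) y.rep := by
      obtain ⟨O, hO, hOY⟩ := isOpen_smoothLocus hY
      have hqO : q ∈ O := (hOY ▸ hq : q ∈ O ∩ Y).1
      rw [← linSpan_inter_plane hO ⟨q, hqO, submodule_le_iff_rep_mem.2 hpq⟩, linSpan,
        Submodule.span_le]
      rintro v ⟨q', ⟨hqO', hqN⟩, hv⟩
      have hq'N : q'.rep ∈ conormal (idealOf X) p.rep := submodule_le_iff_rep_mem.1 hqN
      have hq'Y : q' ∈ Y := h.mem_dual hX hY hYc hp.1.1 hq'N (rep_mem q') q'.rep_nonzero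
      have hq's : q' ∈ smoothLocus Y := by rw [hOY]; exact ⟨hqO', hq'Y⟩
      have h1 := h.conormal_eq_gaussKer_rep hX hY hker hp hq hpq
      have h2 := h.conormal_eq_gaussKer_rep hX hY hker hp hq's hq'N
      rw [h1, ← h2] at hyq
      have h3 := h.symm.rep_mem_conormal_comm hY hX hq'Y hy hyq
      obtain ⟨c, rfl⟩ := exists_smul_rep hv
      exact Submodule.smul_mem _ _ h3
    have heq : conormal (idealOf X) p.rep = conormal (idealOf X) y.rep :=
      Submodule.eq_of_le_of_finrank_eq hle (by
        rw [← ((mem_smoothLocus_iff hX).1 hp.1).2, ((mem_smoothLocus_iff hX).1 hy).2])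
    rw [tangentSpace_eq, tangentSpace_eq, tangent, tangent, heq]

theorem IsConormalPair.exists_leaf_eq (h : IsConormalPair K x ξ) (hX : idealOf X = relIdeal K x)
    (hY : idealOf Y = relIdeal K ξ) (hXc : IsClosed X) (hYc : IsClosed Y)
    (hker : conormal (idealOf Y) ξ = gaussKer (idealOf X) x) {p q : ProjSpace K N}
    (hp : p ∈ regularLocus X (finrank L (gaussKer (idealOf X) x))) (hq : q ∈ smoothLocus Y)
    (hpq : q.rep ∈ conormal (idealOf X) p.rep) :
    IsOpenPartOfPlane (leaf X p) ∧ linSpan (leaf X p) = conormal (idealOf Y) q.rep ∧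
      projDim (leaf X p) = (finrank L (gaussKer (idealOf X) x) : ℤ) - 1 := by
  obtain ⟨O, hO, hOX⟩ := isOpen_smoothLocus hX
  have hleaf : leaf X p = O ∩ plane (conormal (idealOf Y) q.rep) := by
    rw [h.leaf_eq hX hY hYc hker hp hq hpq, hOX, Set.inter_assoc]
    congr 1
    refine Set.inter_eq_right.2 fun y hy => ?_
    exact h.symm.mem_dual hY hX hXc hq.1 (submodule_le_iff_rep_mem.1 hy) (rep_mem y)
      y.rep_nonzero
  have hne : (O ∩ plane (conormal (idealOf Y) q.rep)).Nonempty := by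
    rw [← hleaf]
    exact ⟨p, hp.1, rfl⟩
  have hspan : linSpan (leaf X p) = conormal (idealOf Y) q.rep := by
    rw [hleaf, linSpan_inter_plane hO hne]
  refine ⟨⟨O, hO, by rw [hspan, hleaf]⟩, hspan, ?_⟩
  rw [hleaf, projDim_inter_plane hO hne, h.conormal_eq_gaussKer_rep hX hY hker hp hq hpq, hp.2]

end Contact

universe u

/-! ### The dual variety and the contact loci -/

noncomputable section Duality

variable {K : Type*} [Field K] {L : Type*} [Field L] [Algebra K L] {N : ℕ}
  {X Y : Set (ProjSpace K N)} {x ξ : Fin (N + 1) → L}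

theorem rep_mem_of_mem {q : ProjSpace K N} {w : Fin (N + 1) → K} (hw : w ∈ q.submodule)
    (h0 : w ≠ 0) {W : Submodule K (Fin (N + 1) → K)} (hW : w ∈ W) : q.rep ∈ W := by
  obtain ⟨c, hc, rfl⟩ := exists_ne_zero_smul_rep hw h0
  exact (Submodule.smul_mem_iff W hc).1 hW

theorem ne_zero_of_idealOf_eq (hX : idealOf X = relIdeal K x) (hne : X.Nonempty) : x ≠ 0 := by
  rintro rfl
  obtain ⟨p, hp⟩ := hne
  refine p.rep_nonzero (funext fun i => ?_)
  have h1 := idealOf_le_relIdeal hp (rep_mem p) (show MvPolynomial.X i ∈ idealOf X by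
    rw [hX, mem_relIdeal, aeval_X]; rfl)
  rwa [mem_relIdeal, aeval_X] at h1

/-- Open conditions met by `x` and by `ξ` separately can be met together by a point of `X` and a
covector conormal there. -/
theorem exists_mem_conormal_aeval_ne_zero [Infinite K] (hX : idealOf X = relIdeal K x)
    (hx : x ≠ 0) (hξ : ξ ∈ conormal (relIdeal K x) x) (hξ0 : ξ ≠ 0)
    {f g : MvPolynomial (Fin (N + 1)) K} (hf : aeval x f ≠ 0) (hg : aeval ξ g ≠ 0) :
    ∃ p ∈ X, ∃ v ∈ p.submodule, v ≠ 0 ∧ aeval v f ≠ 0 ∧ ∃ q : ProjSpace K N,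
      ∃ w ∈ q.submodule, w ≠ 0 ∧ aeval w g ≠ 0 ∧ q.rep ∈ conormal (idealOf X) p.rep := by
  obtain ⟨i, hi⟩ := Function.ne_iff.1 hξ0
  obtain ⟨v, ⟨hv0, p, hp, hv⟩, w, hw, hne⟩ := exists_conormal_aeval_ne_zero hξ
    (Z := {v | v ≠ 0 ∧ ∃ p ∈ X, v ∈ p.submodule})
    (fun f hf => by
      obtain ⟨p, hp, v, hv, h0, hfv⟩ := exists_mem_aeval_ne_zero_of_generic hX hx hf
      exact ⟨v, ⟨h0, p, hp, hv⟩, hfv⟩)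
    -- The coordinate factor forces the covector to be nonzero, so that it defines a hyperplane.
    (h := rename Sum.inl f * rename Sum.inr (g * MvPolynomial.X i))
    (by
      simp only [map_mul, aeval_rename, Sum.elim_comp_inl, Sum.elim_comp_inr, rename_X, aeval_X,
        Sum.elim_inr]
      exact mul_ne_zero hf (mul_ne_zero hg hi))
  simp only [map_mul, aeval_rename, Sum.elim_comp_inl, Sum.elim_comp_inr, rename_X, aeval_X,
    Sum.elim_inr] at hne
  have hw0 : w ≠ 0 := fun h0 =>
    right_ne_zero_of_mul (right_ne_zero_of_mul hne) (by rw [h0]; rfl)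
  obtain ⟨q, hq⟩ := exists_point_of_ne_zero hw0
  refine ⟨p, hp, v, hv, hv0, left_ne_zero_of_mul hne, q, w, hq, hw0,
    left_ne_zero_of_mul (right_ne_zero_of_mul hne), rep_mem_of_mem hq hw0 ?_⟩
  obtain ⟨c, hc, rfl⟩ := exists_ne_zero_smul_rep hv hv0
  rwa [← conormal_smul X hc, hX]

theorem isIrreducible_of_idealOf_eq (hY : idealOf Y = relIdeal K ξ) (hξ : ξ ≠ 0) :
    IsIrreducible Y := by
  obtain ⟨q, hq, -⟩ := exists_mem_aeval_ne_zero_of_generic hY hξ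
    (show aeval ξ (1 : MvPolynomial (Fin (N + 1)) K) ≠ 0 by rw [map_one]; exact one_ne_zero)
  refine isIrreducible_of_isPrime ⟨q, hq⟩ ?_
  rw [hY]
  exact RingHom.ker_isPrime _

variable [CharZero K] [Algebra.EssFiniteType K L]

/-- If `ξ` were zero, every conormal vector at points of `X`, being a specialization, would be zero,
against positive codimension. -/
theorem IsConormalPair.right_ne_zero (h : IsConormalPair K x ξ) (hX : idealOf X = relIdeal K x)
    (hx : x ≠ 0) (hpos : 0 < finrank L (conormal (idealOf X) x)) : ξ ≠ 0 := by
  rintro rfl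
  obtain ⟨f, hf, hreg⟩ := exists_generic_regular hX hx
  obtain ⟨p, hp, v, hv, h0, hfv⟩ := exists_mem_aeval_ne_zero_of_generic hX hx hf
  have hps := (mem_smoothLocus_iff hX).1 (hreg p hp v hv h0 hfv).1
  rw [hps.2] at hpos
  obtain ⟨⟨w, hw⟩, hw0⟩ := (finrank_pos_iff_exists_ne_zero (R := K)).1 hpos
  refine hw0 (Subtype.ext (funext fun i => ?_))
  have h1 := h.sumElim_le hX hp hw (show MvPolynomial.X (Sum.inr i) ∈ _ by
    rw [mem_relIdeal, aeval_X]; rfl)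
  rwa [mem_relIdeal, aeval_X] at h1

/-- Tangent hyperplanes are specializations of `ξ`; conversely, a polynomial nonzero at `ξ` is
nonzero at some hyperplane tangent at a smooth point. -/
theorem IsConormalPair.idealOf_dualVariety (h : IsConormalPair K x ξ)
    (hX : idealOf X = relIdeal K x) (hx : x ≠ 0) (hξ : ξ ≠ 0) :
    idealOf (dualVariety X) = relIdeal K ξ := by
  rw [dualVariety, idealOf_closure]
  refine le_antisymm (fun g hg => ?_) fun g hg => mem_idealOf.2 ?_
  · by_contra hgξ
    obtain ⟨f, hf, hreg⟩ := exists_generic_regular hX hx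
    obtain ⟨p, hp, v, hv, hv0, hfv, q, w, hw, hw0, hgw, hpq⟩ :=
      exists_mem_conormal_aeval_ne_zero hX hx h.mem_left hξ hf hgξ
    exact hgw (mem_idealOf.1 hg q
      ⟨p, (hreg p hp v hv hv0 hfv).1, (isTangentAt_iff X q p).2 hpq⟩ w hw)
  · rintro q ⟨p, hp, hpq⟩ w hw
    rw [isTangentAt_iff] at hpq
    obtain ⟨c, rfl⟩ := exists_smul_rep hw
    exact mem_relIdeal.1 (relIdeal_le_of_sumElim_le (relIdeal_sumElim_swap
      (h.sumElim_le hX hp.1 (Submodule.smul_mem _ c hpq))) hg)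

/-- The regular points of `X` with a tangent hyperplane that is a regular point of `Y`. -/
def contactLocus (X Y : Set (ProjSpace K N)) (k l : ℕ) : Set (ProjSpace K N) :=
  {p | p ∈ regularLocus X k ∧ ∃ q ∈ regularLocus Y l, q.rep ∈ conormal (idealOf X) p.rep}

theorem IsConormalPair.isOpen_contactLocus (h : IsConormalPair K x ξ)
    (hX : idealOf X = relIdeal K x) (hY : idealOf Y = relIdeal K ξ) (hYc : IsClosed Y) :
    ∃ O, IsOpen O ∧ contactLocus X Y (finrank L (gaussKer (idealOf X) x))
      (finrank L (gaussKer (idealOf Y) ξ)) = O ∩ X := by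
  refine exists_isOpen_eq_inter (fun p hp => hp.1.1.1) ?_
  rintro p ⟨hp, q, hq, hpq⟩
  obtain ⟨f, hfp, hf⟩ := exists_regular_of_mem_regularLocus hX hp
  obtain ⟨g, hgq, hg⟩ := exists_regular_of_mem_regularLocus hY hq
  obtain ⟨m, c, a, ha, hqa⟩ := exists_sum_of_mem_conormal hpq
  -- The hyperplane `q` is moved along with the point: keeping the coefficients of `q` fixed gives a
  -- polynomial field of conormal vectors, which stays regular and nonzero near `p`.
  let φ : Fin (N + 1) → MvPolynomial (Fin (N + 1)) K := fun i => ∑ j, C (c j) * pderiv i (a j)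
  have hφ : ∀ v : Fin (N + 1) → K, (fun i => aeval v (φ i)) = ∑ j, c j • grad (a j) v := by
    intro v
    funext i
    simp [φ, grad, Finset.sum_apply]
  have hφg : ∀ v : Fin (N + 1) → K, aeval v (aeval φ g) = aeval (fun i => aeval v (φ i)) g :=
    fun v => by rw [← AlgHom.comp_apply, comp_aeval]
  obtain ⟨i, hi⟩ := Function.ne_iff.1 q.rep_nonzero
  refine ⟨f * (aeval φ g * φ i), ⟨p.rep, rep_mem p, ?_⟩, fun p' hp' v hv hv0 hne => ?_⟩
  · rw [map_mul, map_mul, hφg, hφ, ← hqa]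
    refine mul_ne_zero hfp (mul_ne_zero hgq ?_)
    have := congrFun (hφ p.rep) i
    rw [← hqa] at this
    rwa [this]
  · rw [map_mul, map_mul, hφg] at hne
    have hw0 : (fun i => aeval v (φ i)) ≠ 0 := fun h0 =>
      right_ne_zero_of_mul (right_ne_zero_of_mul hne) (congrFun h0 i)
    have hw : (fun i => aeval v (φ i)) ∈ conormal (idealOf X) p'.rep := by
      obtain ⟨e, he, rfl⟩ := exists_ne_zero_smul_rep hv hv0
      rw [← conormal_smul X he, hφ]
      exact Submodule.sum_mem _ fun j _ => Submodule.smul_mem _ _ (grad_mem_conormal (ha j) _)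
    obtain ⟨q', hq'⟩ := exists_point_of_ne_zero hw0
    exact ⟨hf p' hp' v hv hv0 (left_ne_zero_of_mul hne), q',
      hg q' (h.mem_dual hX hY hYc hp' hw hq' hw0) _ hq' hw0
        (left_ne_zero_of_mul (right_ne_zero_of_mul hne)), rep_mem_of_mem hq' hw0 hw⟩

theorem IsConormalPair.nonempty_contactLocus (h : IsConormalPair K x ξ)
    (hX : idealOf X = relIdeal K x) (hY : idealOf Y = relIdeal K ξ) (hYc : IsClosed Y)
    (hx : x ≠ 0) (hξ : ξ ≠ 0) :
    (contactLocus X Y (finrank L (gaussKer (idealOf X) x))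
      (finrank L (gaussKer (idealOf Y) ξ))).Nonempty := by
  obtain ⟨f, hf, hfreg⟩ := exists_generic_regular hX hx
  obtain ⟨g, hg, hgreg⟩ := exists_generic_regular hY hξ
  obtain ⟨p, hp, v, hv, hv0, hfv, q, w, hw, hw0, hgw, hpq⟩ :=
    exists_mem_conormal_aeval_ne_zero hX hx h.mem_left hξ hf hg
  exact ⟨p, hfreg p hp v hv hv0 hfv, q,
    hgreg q (h.mem_dual hX hY hYc hp hpq (rep_mem q) q.rep_nonzero) w hw hw0 hgw, hpq⟩

theorem IsConormalPair.isDenseOpenIn_contactLocus (h : IsConormalPair K x ξ)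
    (hX : idealOf X = relIdeal K x) (hY : idealOf Y = relIdeal K ξ) (hYc : IsClosed Y)
    (hx : x ≠ 0) (hξ : ξ ≠ 0) (hirr : IsIrreducible X) :
    IsDenseOpenIn (contactLocus X Y (finrank L (gaussKer (idealOf X) x))
      (finrank L (gaussKer (idealOf Y) ξ))) X := by
  obtain ⟨O, hO, hOX⟩ := h.isOpen_contactLocus hX hY hYc
  refine ⟨⟨O, hO, hOX⟩, ?_⟩
  have hne := h.nonempty_contactLocus hX hY hYc hx hξ
  rw [hOX] at hne ⊢
  rw [Set.inter_comm] at hne ⊢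
  exact subset_closure_inter_of_isPreirreducible_of_isOpen hirr.2 hO hne

theorem IsConormalPair.exists_mem_contactLocus (h : IsConormalPair K x ξ)
    (hX : idealOf X = relIdeal K x) (hY : idealOf Y = relIdeal K ξ) {k l : ℕ}
    {p : ProjSpace K N} (hp : p ∈ contactLocus X Y k l) :
    ∃ q ∈ contactLocus Y X l k, q.rep ∈ conormal (idealOf X) p.rep := by
  obtain ⟨hp, q, hq, hpq⟩ := hp
  exact ⟨q, ⟨hq, p, hp, h.rep_mem_conormal_comm hX hY hp.1.1 hq.1 hpq⟩, hpq⟩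

theorem exists_generic_conormalPair {K : Type u} [Field K] [CharZero K] {N : ℕ}
    {X : Set (ProjSpace K N)} (hX : IsIrreducible X) :
    ∃ (L : Type u) (_ : Field L) (_ : Algebra K L) (x ξ : Fin (N + 1) → L),
      Algebra.EssFiniteType K L ∧ idealOf X = relIdeal K x ∧ IsConormalPair K x ξ := by
  -- The ideal is made a variable so that it can be replaced by `relIdeal K x` inside the index type
  -- of `t`.
  obtain ⟨I, hI⟩ : ∃ I, I = idealOf X := ⟨_, rfl⟩
  have : I.IsPrime := hI ▸ isPrime_idealOf hX
  obtain ⟨L, _, _, x, t, hx, ht, htop⟩ := exists_generic_extension I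
  have hL : Algebra.EssFiniteType K L :=
    essFiniteType_of_adjoin_eq_top ((Set.finite_range x).union (Set.finite_range t)) htop
  subst hx
  obtain ⟨ξ, h⟩ := isConormalPair_of_algebraicIndependent ht htop fun f hf =>
    grad_dotProduct_self hI.ge (hI.le hf)
  exact ⟨L, _, _, x, ξ, hL, hI.symm, h⟩

end Duality

end GaussDual

/-! ### Assembly of the duality theorem -/

theorem theorem1 {K : Type*} [Field K] [CharZero K] {N n r : ℕ}
    (X : Set (ProjSpace K N)) (hclosed : IsClosed X) (hirr : IsIrreducible X)
    (hdim : projDim X = n) (hn : n < N)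
    (hrank : gaussRank X = r) (hdeg : r < n)
    (hdual : ¬ IsDuallyDegenerate X) :
    IsIrreducible (dualVariety X) ∧
    projDim (dualVariety X) = (N : ℤ) - ((n : ℤ) - r) - 1 ∧
    gaussRank (dualVariety X) = r ∧
    ∃ U U' : Set (ProjSpace K N),
      IsDenseOpenIn U X ∧ U ⊆ smoothLocus X ∧
      IsDenseOpenIn U' (dualVariety X) ∧ U' ⊆ smoothLocus (dualVariety X) ∧
      (∀ x ∈ U, IsOpenPartOfPlane (leaf X x) ∧ projDim (leaf X x) = (n : ℤ) - r) ∧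
      (∀ ξ ∈ U', IsOpenPartOfPlane (leaf (dualVariety X) ξ) ∧
        projDim (leaf (dualVariety X) ξ) = (N : ℤ) - n - 1) ∧
      (∀ x ∈ U, ∃ ξ ∈ U', IsTangentAt X ξ x) ∧
      (∀ ξ ∈ U', ∃ x ∈ U, IsTangentAt X ξ x) ∧
      (∀ x ∈ U, ∀ ξ ∈ U', IsTangentAt X ξ x →
        linSpan (leaf (dualVariety X) ξ) = dualSubspace (tangentSpace X x) ∧
        tangentSpace (dualVariety X) ξ = dualSubspace (linSpan (leaf X x))) := by
  obtain ⟨L, _, _, x, ξ, _, hX, h⟩ := exists_generic_conormalPair hirr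
  have hx := ne_zero_of_idealOf_eq hX hirr.1
  have ht := projDim_eq hX
  have hc := finrank_tangent_add (idealOf X) x
  have hk := gaussRank_add_eq hX hx
  rw [Fintype.card_fin] at hc
  -- The generic conormal space has dimension `N - n`, positive because `n < N`.
  have hξ := h.right_ne_zero hX hx (by omega)
  have hY := h.idealOf_dualVariety hX hx hξ
  have hYc : IsClosed (dualVariety X) := isClosed_closure
  have ht' := projDim_eq hY
  have hc' := finrank_tangent_add (idealOf (dualVariety X)) ξ
  rw [Fintype.card_fin] at hc'
  have hk' := gaussRank_add_eq hY hξ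
  have hle : gaussKer (idealOf X) x ≤ conormal (idealOf (dualVariety X)) ξ := by
    rw [hX, hY]
    exact gaussKer_le_conormal h.mem_left
  have hker : conormal (idealOf (dualVariety X)) ξ = gaussKer (idealOf X) x := by
    -- The Gauss kernel has dimension `n + 1 - r = l + 1`, and dual nondegeneracy bounds the
    -- conormal dimension `N - dim X*` by the same number.
    refine (Submodule.eq_of_le_of_finrank_le hle ?_).symm
    rw [IsDuallyDegenerate, gaussDefect] at hdual
    omega
  have hker' : conormal (idealOf X) x = gaussKer (idealOf (dualVariety X)) ξ := by
    rw [hX, hY] at hker ⊢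
    exact le_antisymm (conormal_le_gaussKer hker.le) (gaussKer_le_conormal h.mem_right)
  have he : Module.finrank L (conormal (idealOf (dualVariety X)) ξ) =
      Module.finrank L (gaussKer (idealOf X) x) := by rw [hker]
  have he' : Module.finrank L (conormal (idealOf X) x) =
      Module.finrank L (gaussKer (idealOf (dualVariety X)) ξ) := by rw [hker']
  have hYirr := isIrreducible_of_idealOf_eq hY hξ
  -- The conormal dimension of `X*` is `l + 1`, so its cone has dimension `N - l`; subtracting its
  -- Gauss kernel, of dimension `N - n`, leaves rank `n - l = r`.
  refine ⟨hYirr, by omega, by omega, _, _,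
    h.isDenseOpenIn_contactLocus hX hY hYc hx hξ hirr, fun p hp => hp.1.1,
    h.symm.isDenseOpenIn_contactLocus hY hX hclosed hξ hx hYirr, fun q hq => hq.1.1, ?_, ?_, ?_,
    ?_, ?_⟩
  · rintro p ⟨hp, q, hq, hpq⟩
    obtain ⟨h1, -, h3⟩ := h.exists_leaf_eq hX hY hclosed hYc hker hp hq.1 hpq
    exact ⟨h1, by omega⟩
  · rintro q ⟨hq, p, hp, hpq⟩
    obtain ⟨h1, -, h3⟩ := h.symm.exists_leaf_eq hY hX hYc hclosed hker' hq hp.1 hpq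
    exact ⟨h1, by omega⟩
  · intro p hp
    simp only [isTangentAt_iff]
    exact h.exists_mem_contactLocus hX hY hp
  · rintro q hq
    simp only [isTangentAt_iff]
    obtain ⟨p, hp, hpq⟩ := h.symm.exists_mem_contactLocus hY hX hq
    exact ⟨p, hp, h.symm.rep_mem_conormal_comm hY hX hq.1.1.1 hp.1.1 hpq⟩
  · intro p hp q hq hpq
    rw [isTangentAt_iff] at hpq
    have hqp := h.rep_mem_conormal_comm hX hY hp.1.1.1 hq.1.1 hpq
    obtain ⟨-, h1, -⟩ := h.exists_leaf_eq hX hY hclosed hYc hker hp.1 hq.1.1 hpq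
    obtain ⟨-, h2, -⟩ := h.symm.exists_leaf_eq hY hX hYc hclosed hker' hq.1 hp.1.1 hqp
    refine ⟨by rw [h2, dualSubspace_tangentSpace], ?_⟩
    rw [h1, tangentSpace_eq, dualSubspace_eq]
    rfl
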